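/- A noncommutative probability space is a pair $(\mathcal A,\varphi)$ of a complex unital algebra and a unital linear functional. An exchangeability system $\mathcal E$ for $(\mathcal A,\varphi)$ consists of a noncommutative probability space $(\mathcal U,\tilde\varphi)$ and injective unital homomorphisms $\mathcal A\to\mathcal U$, $X\mapsto X^{(k)}$ ($k\in\mathbb N$), with $\tilde\varphi(X^{(k)})=\varphi(X)$, such that $\tilde\varphi(X_1^{(h(1))}\cdots X_n^{(h(n))})=\tilde\varphi(X_1^{(\sigma(h(1)))}\cdots X_n^{(\sigma(h(n)))})$ for all $X_j\in\mathcal A$, all $h:[n]\to\mathbb N$ and all permutations $\sigma$ of $\mathbb N$. For a set partition $\pi$ of $[n]$ let $\varphi^{\mathcal E}_\pi(X_1,\dots,X_n)=\tilde\varphi(X_1^{(h(1))}\cdots X_n^{(h(n))})$, where $h:[n]\to\mathbb N$ is any map with $h(i)=h(j)\iff i\sim_\pi j$, and define the partitioned cumulant $$K^{\mathcal E}_\pi(X_1,\dots,X_n)=\sum_{\sigma\le\pi}\varphi^{\mathcal E}_\sigma(X_1,\dots,X_n)\,\mu(\sigma,\pi),$$ with $\mu$ the Möbius function of the lattice of set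 partitions ordered by refinement. If $\rho$ is a partition of a subset $B\subseteq[n]$, then $K^{\mathcal E}_\rho(X_1,\dots,X_n)$ means $K^{\mathcal E}_\rho(X_j:j\in B)$, the indices being taken in increasing order (it equals $1$ if $B=\emptyset$). Let $\mathcal A$ be a complex unital algebra with two unital linear functionals $\varphi,\psi$, and let $\mathcal U=\bigstar_{k\in\mathbb N}\mathcal A^{(k)}$ be the unital free product of copies of $\mathcal A$. Let $\tilde\psi$ be the free product functional, i.e. the unital linear functional with $\tilde\psi(X_1^{(i_1)}\cdots X_m^{(i_m)})=0$ whenever $m\ge1$, $\psi(X_j)=0$ for all $j$ and $i_j\ne i_{j+1}$; let $\tilde\varphi$ be the conditionally free product functional, i.e. the unital linear functional with $\tilde\varphi(X_1^{(i_1)}\cdots X_m^{(i_m)})=\varphi(X_1)\cdots\varphi(X_m)$ whenever $\psi(X_j)=0$ for all $j$ and $i_j\ne i_{j+1}$. Denote by $K^{\mathcal{CF}}_\pi$ the partitioned cumulants of the exchangeability system $(\mathcal U,\tilde\varphi)$ for $(\mathcal A,\varphi)$, and by $K^{\mathcal F,\psi}_\pi$ those of the exchangeability system $(\mathcal U,\tilde\psi)$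 for $(\mathcal A,\psi)$ (the free cumulants with respect to $\psi$). Two blocks $B\neq B'$ of $\pi$ cross if there are $i<j<k<l$ such that $i,k$ lie in one of them and $j,l$ in the other; $\pi$ is noncrossing if no two of its blocks cross. The connected components of $\pi$ are the classes of blocks under the equivalence relation generated by crossing, and $\pi$ is irreducible if $n\ge1$ and $1$ and $n$ lie in the same connected component. Let $X_1,\dots,X_n\in\mathcal A$ and let $\pi$ be a partition of $[n]$. (1) Suppose that $\pi$ is irreducible. Let $\pi_1$ be its outer connected component (the one containing $1$ and $n$) and let $\pi_2$ be the (possibly empty) partition formed by the blocks of all the other (inner) components. Then $$K^{\mathcal{CF}}_\pi(X_1,\dots,X_n)=K^{\mathcal{CF}}_{\pi_1}(X_1,\dots,X_n)\;K^{\mathcal F,\psi}_{\pi_2}(X_1,\dots,X_n),$$ and $K^{\mathcal F,\psi}_{\pi_2}(X_1,\dots,X_n)=0$ (so that $K^{\mathcal{CF}}_\pi(X_1,\dots,X_n)=0$) unless $\pi_2$ is noncrossing. (2) For every partition $\pi$ of $[n]$, irreducible or not, $K^{\mathcal{CF}}_\pi(X_1,\dots,X_n)=0$ unless $\pi$ is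 noncrossing. -/

import Mathlib

open LinearAlgebra

namespace CFree

universe u

variable {A : Type u} [Ring A] [Algebra ℂ A]

/-! ### Exchangeability systems, partitioned moments and partitioned cumulants -/

/-- An exchangeability system for the noncommutative probability space `(A, φ)` (a complex unital
algebra with a unital linear functional): a noncommutative probability space `(U, state)` and an
infinite family of state-preserving embeddings `ι k : A → U`, `X ↦ X⁽ᵏ⁾`, whose ranges are
interchangeable.  (A semiring which is a complex algebra is automatically a ring.) -/
structure ExchangeabilitySystem (φ : A →ₗ[ℂ] ℂ) where
  U : Type u
  [semiringU : Semiring U]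
  [algebraU : Algebra ℂ U]
  state : U →ₗ[ℂ] ℂ
  state_one : state 1 = 1
  ι : ℕ → A →ₐ[ℂ] U
  ι_injective : ∀ k, Function.Injective (ι k)
  state_ι : ∀ k a, state (ι k a) = φ a
  interchangeable : ∀ (n : ℕ) (X : Fin n → A) (h : Fin n → ℕ) (σ : Equiv.Perm ℕ),
    state (List.ofFn fun j => ι (h j) (X j)).prod
      = state (List.ofFn fun j => ι (σ (h j)) (X j)).prod

attribute [instance] ExchangeabilitySystem.semiringU ExchangeabilitySystem.algebraU

/-- Partitions of `[n]` are equivalence relations on `Fin n`, with the refinement order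
of `Setoid`. -/
noncomputable instance (n : ℕ) : Fintype (Setoid (Fin n)) :=
  Fintype.ofInjective (fun (s : Setoid (Fin n)) => (fun p : Fin n × Fin n => s p.1 p.2))
    (fun _ _ h => Setoid.ext fun a b => iff_of_eq (congrFun h (a, b)))

open Classical in
noncomputable instance (n : ℕ) : LocallyFiniteOrder (Setoid (Fin n)) :=
  Fintype.toLocallyFiniteOrder

open Classical in
/-- A canonical index map `Fin n → ℕ` with kernel `π`: the smallest element of the block. -/
noncomputable def blockIndex {n : ℕ} (π : Setoid (Fin n)) (j : Fin n) : ℕ :=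
  ((Finset.univ.filter fun i => π i j).min' ⟨j, by simp⟩ : Fin n)

theorem ker_blockIndex {n : ℕ} (π : Setoid (Fin n)) : Setoid.ker (blockIndex π) = π := by
  classical
  ext i j
  rw [Setoid.ker_def]
  constructor
  · intro h
    have h1 := Finset.min'_mem (Finset.univ.filter fun k => π k i) ⟨i, by simp⟩
    have h2 := Finset.min'_mem (Finset.univ.filter fun k => π k j) ⟨j, by simp⟩
    simp only [Finset.mem_filter, Finset.mem_univ, true_and] at h1 h2
    unfold blockIndex at h
    rw [Fin.val_injective h] at h1
    exact π.trans' (π.symm' h1) h2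
  · intro h
    have : (Finset.univ.filter fun k => π k i) = (Finset.univ.filter fun k => π k j) := by
      ext k
      simp only [Finset.mem_filter, Finset.mem_univ, true_and]
      exact ⟨fun hk => π.trans' hk h, fun hk => π.trans' hk (π.symm' h)⟩
    unfold blockIndex
    simp only [this]

namespace ExchangeabilitySystem

variable {φ : A →ₗ[ℂ] ℂ} (E : ExchangeabilitySystem φ)

/-- The partitioned expectation `φ_π(X₁, …, Xₙ)`: the expectation of
`X₁^(h 1) ⋯ Xₙ^(h n)` for any index map `h` with kernel `π`. -/
noncomputable def moment {n : ℕ} (π : Setoid (Fin n)) (X : Fin n → A) : ℂ :=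
  E.state (List.ofFn fun j => E.ι (blockIndex π j) (X j)).prod

/-- The partitioned expectation does not depend on the choice of the index map. -/
theorem moment_eq {n : ℕ} (π : Setoid (Fin n)) (X : Fin n → A) (h : Fin n → ℕ)
    (hh : Setoid.ker h = π) :
    E.moment π X = E.state (List.ofFn fun j => E.ι (h j) (X j)).prod := by
  classical
  subst hh
  obtain ⟨σ, hσ⟩ : ∃ σ : Equiv.Perm ℕ, ∀ j, σ (blockIndex (Setoid.ker h) j) = h j := by
    let b := blockIndex (Setoid.ker h)
    have hb : ∀ i j, b i = b j ↔ h i = h j := fun i j => by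
      rw [← Setoid.ker_def (f := h), ← ker_blockIndex (Setoid.ker h), Setoid.ker_def]
    let f : Set.range b → ℕ := fun x => h x.2.choose
    have hf : ∀ j, f ⟨b j, j, rfl⟩ = h j := fun j =>
      (hb _ _).1 (Exists.choose_spec (⟨j, rfl⟩ : ∃ k, b k = b j))
    have hfi : Function.Injective f := by
      rintro ⟨_, i, rfl⟩ ⟨_, j, rfl⟩ hij
      rw [hf, hf] at hij
      exact Subtype.ext ((hb i j).2 hij)
    have := Equiv.Perm.isMultiplyPretransitive ℕ (Fintype.card (Set.range b))
    let e := Fintype.equivFin (Set.range b)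
    obtain ⟨σ, hσ⟩ := MulAction.exists_smul_eq (Equiv.Perm ℕ)
      (e.symm.toEmbedding.trans (Function.Embedding.subtype _))
      (e.symm.toEmbedding.trans ⟨f, hfi⟩)
    refine ⟨σ, fun j => ?_⟩
    have := congrArg (fun g => g (e ⟨b j, j, rfl⟩)) hσ
    simpa [hf] using this
  rw [moment, E.interchangeable n X _ σ]
  simp only [hσ]

open Classical in
/-- The partitioned cumulant `K_π = ∑_{σ ≤ π} φ_σ μ(σ, π)`, where `μ` is the Möbius function of
the lattice of partitions. -/
noncomputable def cumulant {n : ℕ} (π : Setoid (Fin n)) (X : Fin n → A) : ℂ :=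
  ∑ σ ∈ Finset.Iic π, E.moment σ X * IncidenceAlgebra.mu ℂ σ π

end ExchangeabilitySystem

/-- The restriction of a partition of `[n]` to a subset `B`, the elements of `B` being
renumbered increasingly. -/
def restrict {n : ℕ} (π : Setoid (Fin n)) (B : Finset (Fin n)) : Setoid (Fin B.card) :=
  Setoid.comap (B.orderEmbOfFin rfl) π

/-- The subfamily `(X_j : j ∈ B)`, in increasing order of the indices. -/
def subfamily {n : ℕ} {α : Type*} (X : Fin n → α) (B : Finset (Fin n)) : Fin B.card → α :=
  fun j => X (B.orderEmbOfFin rfl j)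

/-! ### Noncrossing, connected and irreducible partitions -/

/-- No `i < j < k < l` with `i ∼ k`, `j ∼ l`, `i ≁ j`. -/
def IsNoncrossing {n : ℕ} (π : Setoid (Fin n)) : Prop :=
  ¬ ∃ i j k l : Fin n, i < j ∧ j < k ∧ k < l ∧ π i k ∧ π j l ∧ ¬ π i j

/-- The blocks of `x` and `y` cross. -/
def BlocksCross {n : ℕ} (π : Setoid (Fin n)) (x y : Fin n) : Prop :=
  ¬ π x y ∧ ∃ i j k l : Fin n, i < j ∧ j < k ∧ k < l ∧
    ((π x i ∧ π x k ∧ π y j ∧ π y l) ∨ (π y i ∧ π y k ∧ π x j ∧ π x l))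

/-- The equivalence relation "`x` and `y` lie in the same connected component of (the picture of)
`π`": two points are linked directly if they are in the same block or in crossing blocks. -/
def component {n : ℕ} (π : Setoid (Fin n)) : Setoid (Fin n) :=
  Relation.EqvGen.setoid fun x y => π x y ∨ BlocksCross π x y

/-- The first and the last point lie in the same connected component. -/
def IsIrreducible {n : ℕ} (π : Setoid (Fin n)) : Prop :=
  ∃ h : 0 < n, component π ⟨0, h⟩ ⟨n - 1, Nat.sub_lt h Nat.one_pos⟩

open Classical in
/-- The support of the outer connected component of an irreducible partition: the connected
component of the first point. -/
noncomputable def outerPart {n : ℕ} (π : Setoid (Fin n)) : Finset (Fin n) :=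
  Finset.univ.filter fun j => ∃ h : 0 < n, component π ⟨0, h⟩ j

/-- The union of the supports of the inner connected components of an irreducible partition. -/
noncomputable def innerPart {n : ℕ} (π : Setoid (Fin n)) : Finset (Fin n) := (outerPart π)ᶜ

/-! ### The free and the conditionally free product of infinitely many copies -/

/-- The free product of the copies `A⁽ᵏ⁾`, `k ∈ ℕ`, of the algebra `A`. -/
abbrev FreePower (A : Type u) [Ring A] [Algebra ℂ A] : Type u := FreeProduct ℂ (fun _ : ℕ => A)

/-- The embedding of `A` as the `k`-th free factor. -/
noncomputable abbrev copy (k : ℕ) : A →ₐ[ℂ] FreePower A := FreeProduct.ι ℂ (fun _ : ℕ => A) k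

/-- An alternating word in `ψ`-centred elements: a list of pairs `(i, a)`, standing for the
element `a⁽ⁱ⁾`, such that `ψ a = 0` for all letters and neighbouring indices are different. -/
def IsCentredAlternating (ψ : A →ₗ[ℂ] ℂ) (w : List (ℕ × A)) : Prop :=
  (∀ p ∈ w, ψ p.2 = 0) ∧ (w.map Prod.fst).IsChain (· ≠ ·)

/-- The defining condition of the free product state: it is unital and vanishes on
nonempty alternating words in centred elements. -/
def IsFreeState (ψ : A →ₗ[ℂ] ℂ) (Ψ : FreePower A →ₗ[ℂ] ℂ) : Prop :=
  Ψ 1 = 1 ∧ ∀ w : List (ℕ × A), w ≠ [] → IsCentredAlternating ψ w →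
    Ψ (w.map fun p => copy p.1 p.2).prod = 0

/-- The defining condition of the conditionally free product state: it is unital and
`Φ(X₁ ⋯ Xₙ) = φ(X₁) ⋯ φ(Xₙ)` for alternating words in `ψ`-centred elements. -/
def IsCondFreeState (φ ψ : A →ₗ[ℂ] ℂ) (Φ : FreePower A →ₗ[ℂ] ℂ) : Prop :=
  Φ 1 = 1 ∧ ∀ w : List (ℕ × A), IsCentredAlternating ψ w →
    Φ (w.map fun p => copy p.1 p.2).prod = (w.map fun p => φ p.2).prod

section Existence

/-! Existence: `A⁽ⁱ⁾` acts on the multilinear functions on alternating words of centred letters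
(words are stored in reverse order). -/

variable (ψ : A →ₗ[ℂ] ℂ)

/-- `a - ψ(a) 1` -/
def centre (hψ : ψ 1 = 1) : A →ₗ[ℂ] LinearMap.ker ψ :=
  LinearMap.codRestrict _ (LinearMap.id - ψ.smulRight 1) (fun a => by simp [hψ])

theorem coe_centre {ψ : A →ₗ[ℂ] ℂ} (hψ : ψ 1 = 1) (a : A) :
    (centre ψ hψ a : A) = a - ψ a • 1 := rfl

/-- The multilinear functions supported on alternating words. -/
def wordFun : Submodule ℂ (List (ℕ × LinearMap.ker ψ) → ℂ) where
  carrier := {f | (∀ u v i a b, f (u ++ (i, a + b) :: v) = f (u ++ (i, a) :: v) + f (u ++ (i, b) :: v))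
    ∧ (∀ u v i (c : ℂ) a, f (u ++ (i, c • a) :: v) = c * f (u ++ (i, a) :: v))
    ∧ ∀ w, ¬ (w.map Prod.fst).IsChain (· ≠ ·) → f w = 0}
  zero_mem' := by simp
  add_mem' := by
    rintro f g ⟨h1, h2, h3⟩ ⟨k1, k2, k3⟩
    refine ⟨fun u v i a b => ?_, fun u v i c a => ?_, fun w hw => ?_⟩
    · simp only [Pi.add_apply, h1, k1]; ring
    · simp only [Pi.add_apply, h2, k2]; ring
    · simp [h3 w hw, k3 w hw]
  smul_mem' := by
    rintro c f ⟨h1, h2, h3⟩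
    refine ⟨fun u v i a b => ?_, fun u v i d a => ?_, fun w hw => ?_⟩
    · simp only [Pi.smul_apply, h1, smul_eq_mul]; ring
    · simp only [Pi.smul_apply, h2, smul_eq_mul]; ring
    · simp [h3 w hw]

variable {ψ} (hψ : ψ 1 = 1)

/-- Append a letter `x ∈ A⁽ⁱ⁾` to a word that does not end in `A⁽ⁱ⁾`. -/
def appendFun (i : ℕ) (f : List (ℕ × LinearMap.ker ψ) → ℂ) (x : A)
    (w : List (ℕ × LinearMap.ker ψ)) : ℂ :=
  f ((i, centre ψ hψ x) :: w) + ψ x * f w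

open Classical in
/-- The action of `a ∈ A⁽ⁱ⁾` on functions on words. -/
noncomputable def actFun (i : ℕ) (a : A) (f : List (ℕ × LinearMap.ker ψ) → ℂ) :
    List (ℕ × LinearMap.ker ψ) → ℂ
  | [] => appendFun hψ i f a []
  | (j, b) :: w => if (j :: w.map Prod.fst).IsChain (· ≠ ·) then
      (if j = i then appendFun hψ i f ((b : A) * a) w else appendFun hψ i f a ((j, b) :: w))
      else 0

theorem appendFun_add (i : ℕ) {f} (hf : f ∈ wordFun ψ) (x y : A) (w) :
    appendFun hψ i f (x + y) w = appendFun hψ i f x w + appendFun hψ i f y w := by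
  have := hf.1 [] w i (centre ψ hψ x) (centre ψ hψ y)
  simp only [List.nil_append] at this
  simp only [appendFun, map_add, this]; ring

theorem appendFun_smul (i : ℕ) {f} (hf : f ∈ wordFun ψ) (c : ℂ) (x : A) (w) :
    appendFun hψ i f (c • x) w = c * appendFun hψ i f x w := by
  have := hf.2.1 [] w i c (centre ψ hψ x)
  simp only [List.nil_append] at this
  simp only [appendFun, map_smul, this, smul_eq_mul]; ring

theorem appendFun_mem_add (i : ℕ) {f} (hf : f ∈ wordFun ψ) (x : A) (u v j a b) :
    appendFun hψ i f x (u ++ (j, a + b) :: v)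
      = appendFun hψ i f x (u ++ (j, a) :: v) + appendFun hψ i f x (u ++ (j, b) :: v) := by
  have := hf.1 ((i, centre ψ hψ x) :: u) v j a b
  simp only [List.cons_append] at this
  simp only [appendFun, this, hf.1 u v j a b]; ring

theorem appendFun_mem_smul (i : ℕ) {f} (hf : f ∈ wordFun ψ) (x : A) (u v j) (c : ℂ) (a) :
    appendFun hψ i f x (u ++ (j, c • a) :: v)
      = c * appendFun hψ i f x (u ++ (j, a) :: v) := by
  have := hf.2.1 ((i, centre ψ hψ x) :: u) v j c a
  simp only [List.cons_append] at this
  simp only [appendFun, this, hf.2.1 u v j c a]; ring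

theorem actFun_mem (i : ℕ) (a : A) {f} (hf : f ∈ wordFun ψ) : actFun hψ i a f ∈ wordFun ψ := by
  refine ⟨fun u v j x y => ?_, fun u v j c x => ?_, fun w hw => ?_⟩
  · cases u with
    | nil =>
      simp only [List.nil_append, actFun]
      split_ifs
      · simp only [Submodule.coe_add, add_mul, appendFun_add hψ i hf]
      · exact appendFun_mem_add hψ i hf a [] v j x y
      · simp
    | cons p u =>
      obtain ⟨k, b⟩ := p
      simp only [List.cons_append, actFun, List.map_cons, List.map_append]
      split_ifs
      · exact appendFun_mem_add hψ i hf _ u v j x y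
      · exact appendFun_mem_add hψ i hf a ((k, b) :: u) v j x y
      · simp
  · cases u with
    | nil =>
      simp only [List.nil_append, actFun]
      split_ifs
      · simp only [Submodule.coe_smul, smul_mul_assoc, appendFun_smul hψ i hf]
      · exact appendFun_mem_smul hψ i hf a [] v j c x
      · simp
    | cons p u =>
      obtain ⟨k, b⟩ := p
      simp only [List.cons_append, actFun, List.map_cons, List.map_append]
      split_ifs
      · exact appendFun_mem_smul hψ i hf _ u v j c x
      · exact appendFun_mem_smul hψ i hf a ((k, b) :: u) v j c x
      · simp
  · cases w with
    | nil => simp at hw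
    | cons p w => exact if_neg hw

theorem actFun_of_chain (i : ℕ) (a : A) (f) (w : List (ℕ × LinearMap.ker ψ))
    (hw : (i :: w.map Prod.fst).IsChain (· ≠ ·)) :
    actFun hψ i a f w = appendFun hψ i f a w := by
  cases w with
  | nil => rfl
  | cons p w =>
    obtain ⟨j, b⟩ := p
    simp only [List.map_cons, List.isChain_cons_cons] at hw
    rw [actFun, if_pos hw.2, if_neg hw.1.symm]

theorem actFun_head (i : ℕ) (a : A) (f) (b) (w : List (ℕ × LinearMap.ker ψ))
    (hw : (i :: w.map Prod.fst).IsChain (· ≠ ·)) :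
    actFun hψ i a f ((i, b) :: w) = appendFun hψ i f ((b : A) * a) w := by
  rw [actFun, if_pos hw, if_pos rfl]

theorem appendFun_actFun (i : ℕ) (x a : A) {f} (hf : f ∈ wordFun ψ)
    (w : List (ℕ × LinearMap.ker ψ)) (hw : (i :: w.map Prod.fst).IsChain (· ≠ ·)) :
    appendFun hψ i (actFun hψ i a f) x w = appendFun hψ i f (x * a) w := by
  rw [appendFun, actFun_head hψ i a f _ w hw, actFun_of_chain hψ i a f w hw,
    ← appendFun_smul hψ i hf, ← appendFun_add hψ i hf]
  congr 1
  simp [coe_centre, sub_mul]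

/-- A nonchain is killed; otherwise either the first index is `i` or `i` can be prepended. -/
theorem wordFun_ext (i : ℕ) {f g} (hf : f ∈ wordFun ψ) (hg : g ∈ wordFun ψ)
    (h1 : ∀ w, (i :: w.map Prod.fst).IsChain (· ≠ ·) → f w = g w)
    (h2 : ∀ b w, (i :: w.map Prod.fst).IsChain (· ≠ ·) → f ((i, b) :: w) = g ((i, b) :: w)) :
    f = g := by
  funext w
  by_cases hw : (w.map Prod.fst).IsChain (· ≠ ·)
  · cases w with
    | nil => exact h1 [] (by simp)
    | cons p w =>
      obtain ⟨j, b⟩ := p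
      by_cases hj : j = i
      · subst hj; exact h2 b w hw
      · exact h1 _ (by simpa [List.isChain_cons_cons] using ⟨Ne.symm hj, hw⟩)
  · rw [hf.2.2 w hw, hg.2.2 w hw]

theorem actFun_one (i : ℕ) {f} (hf : f ∈ wordFun ψ) : actFun hψ i 1 f = f := by
  have h0 : ∀ w, f ((i, 0) :: w) = 0 := fun w => by
    simpa using hf.2.1 [] w i 0 0
  refine wordFun_ext i (actFun_mem hψ i 1 hf) hf (fun w hw => ?_) (fun b w hw => ?_)
  · rw [actFun_of_chain hψ i 1 f w hw, appendFun]
    have : centre ψ hψ 1 = 0 := Subtype.ext (by simp [coe_centre, hψ])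
    simp [this, h0, hψ]
  · rw [actFun_head hψ i 1 f b w hw, appendFun]
    have : centre ψ hψ (b : A) = b := Subtype.ext (by simp [coe_centre])
    simp [this]

theorem actFun_mul (i : ℕ) (a b : A) {f} (hf : f ∈ wordFun ψ) :
    actFun hψ i (a * b) f = actFun hψ i a (actFun hψ i b f) := by
  refine wordFun_ext i (actFun_mem hψ i _ hf) (actFun_mem hψ i _ (actFun_mem hψ i _ hf))
    (fun w hw => ?_) (fun c w hw => ?_)
  · rw [actFun_of_chain hψ i _ _ w hw, actFun_of_chain hψ i _ _ w hw,
      appendFun_actFun hψ i a b hf w hw]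
  · rw [actFun_head hψ i _ _ c w hw, actFun_head hψ i _ _ c w hw,
      appendFun_actFun hψ i _ b hf w hw, mul_assoc]

theorem actFun_lin (i : ℕ) {f} (hf : f ∈ wordFun ψ) (c : ℂ) (a b : A) :
    actFun hψ i (c • a + b) f = c • actFun hψ i a f + actFun hψ i b f := by
  refine wordFun_ext i (actFun_mem hψ i _ hf)
    (add_mem (Submodule.smul_mem _ _ (actFun_mem hψ i _ hf)) (actFun_mem hψ i _ hf))
    (fun w hw => ?_) (fun d w hw => ?_)
  · simp only [Pi.add_apply, Pi.smul_apply, actFun_of_chain hψ i _ _ w hw,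
      appendFun_add hψ i hf, appendFun_smul hψ i hf, smul_eq_mul]
  · simp only [Pi.add_apply, Pi.smul_apply, actFun_head hψ i _ _ d w hw, mul_add,
      mul_smul_comm, appendFun_add hψ i hf, appendFun_smul hψ i hf, smul_eq_mul]

theorem actFun_lin_right (i : ℕ) (a : A) {f g} (hf : f ∈ wordFun ψ) (hg : g ∈ wordFun ψ) (c : ℂ) :
    actFun hψ i a (c • f + g) = c • actFun hψ i a f + actFun hψ i a g := by
  have hfg := add_mem (Submodule.smul_mem _ c hf) hg
  refine wordFun_ext i (actFun_mem hψ i _ hfg)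
    (add_mem (Submodule.smul_mem _ _ (actFun_mem hψ i _ hf)) (actFun_mem hψ i _ hg))
    (fun w hw => ?_) (fun d w hw => ?_)
  · simp only [Pi.add_apply, Pi.smul_apply, actFun_of_chain hψ i _ _ w hw, appendFun,
      smul_eq_mul]; ring
  · simp only [Pi.add_apply, Pi.smul_apply, actFun_head hψ i _ _ d w hw, appendFun,
      smul_eq_mul]; ring

/-- The action as an endomorphism. -/
noncomputable def actEnd (i : ℕ) (a : A) : Module.End ℂ (wordFun ψ) where
  toFun f := ⟨actFun hψ i a f, actFun_mem hψ i a f.2⟩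
  map_add' f g := Subtype.ext (by
    simpa using actFun_lin_right hψ i a f.2 g.2 1)
  map_smul' c f := Subtype.ext (by
    have h0 : actFun hψ i a 0 = 0 := by
      simpa using actFun_lin_right hψ i a (zero_mem _) (zero_mem _) (-1)
    simpa [h0] using actFun_lin_right hψ i a f.2 (zero_mem _) c)

/-- The action as an algebra homomorphism. -/
noncomputable def actHom (i : ℕ) : A →ₐ[ℂ] Module.End ℂ (wordFun ψ) :=
  AlgHom.ofLinearMap
    { toFun := actEnd hψ i
      map_add' := fun a b => LinearMap.ext fun f => Subtype.ext (by
        simpa [actEnd] using actFun_lin hψ i f.2 1 a b)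
      map_smul' := fun c a => LinearMap.ext fun f => Subtype.ext (by
        have h0 : actFun hψ i 0 (f : List (ℕ × LinearMap.ker ψ) → ℂ) = 0 := by
          simpa using actFun_lin hψ i f.2 (-1) 0 0
        simpa [actEnd, h0] using actFun_lin hψ i f.2 c a 0) }
    (LinearMap.ext fun f => Subtype.ext (actFun_one hψ i f.2))
    (fun a b => LinearMap.ext fun f => Subtype.ext (actFun_mul hψ i a b f.2))

open Classical in
/-- The function `w ↦ ∏ φ(wⱼ)` on alternating words. -/
noncomputable def prodFun (φ : A →ₗ[ℂ] ℂ) : wordFun ψ :=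
  ⟨fun w => if (w.map Prod.fst).IsChain (· ≠ ·) then (w.map fun p => φ (p.2 : A)).prod else 0, by
    refine ⟨fun u v i a b => ?_, fun u v i c a => ?_, fun w hw => ?_⟩
    · simp only [List.map_append, List.map_cons]
      split_ifs
      · simp; ring
      · simp
    · simp only [List.map_append, List.map_cons]
      split_ifs
      · simp; ring
      · simp
    · simp only [if_neg hw]⟩

theorem exists_condFreeState (φ : A →ₗ[ℂ] ℂ) (hψ : ψ 1 = 1) :
    ∃ Φ : FreePower A →ₗ[ℂ] ℂ, IsCondFreeState φ ψ Φ := by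
  let ρ : FreePower A →ₐ[ℂ] Module.End ℂ (wordFun ψ) :=
    FreeProduct.lift ℂ (fun _ : ℕ => A) (fun {i} => actHom hψ i)
  have hρ : ∀ i a, ρ (copy i a) = actHom hψ i a := fun i a => by
    have := FreeProduct.lift_comp_ι (I := ℕ) ℂ (fun _ : ℕ => A) (fun {i} => actHom hψ i) (i := i)
    exact congrArg (fun g => g a) this
  let Φ : FreePower A →ₗ[ℂ] ℂ :=
    { toFun := fun x => (ρ x (prodFun φ) : List (ℕ × LinearMap.ker ψ) → ℂ) []
      map_add' := fun x y => by simp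
      map_smul' := fun c x => by simp }
  have key : ∀ (w : List (ℕ × A)), IsCentredAlternating ψ w →
      ∀ u : List (ℕ × LinearMap.ker ψ),
      ((u.map Prod.fst).reverse ++ w.map Prod.fst).IsChain (· ≠ ·) →
      (ρ (w.map fun p => copy p.1 p.2).prod (prodFun φ) : List (ℕ × LinearMap.ker ψ) → ℂ) u
        = (u.map fun p => φ (p.2 : A)).prod * (w.map fun p => φ p.2).prod := by
    intro w
    induction w with
    | nil =>
      intro _ u hu
      have hu' : (u.map Prod.fst).IsChain (· ≠ ·) := by
        have := List.isChain_reverse.1 (by simpa using hu)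
        exact this.imp (fun _ _ h => Ne.symm h)
      simp [prodFun, hu']
    | cons p w ih =>
      obtain ⟨i, a⟩ := p
      intro hw u hu
      have ha : ψ a = 0 := hw.1 (i, a) (by simp)
      have hw' : IsCentredAlternating ψ w :=
        ⟨fun p hp => hw.1 p (by simp [hp]), by
          have := hw.2; rw [List.map_cons] at this; exact this.tail⟩
      have hc : centre ψ hψ a = ⟨a, ha⟩ := Subtype.ext (by simp [coe_centre, ha])
      have hiu : (i :: u.map Prod.fst).IsChain (· ≠ ·) := by
        have h1 : ((u.map Prod.fst).reverse ++ [i]).IsChain (· ≠ ·) := by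
          have : (u.map Prod.fst).reverse ++ ((i, a) :: w).map Prod.fst
            = ((u.map Prod.fst).reverse ++ [i]) ++ w.map Prod.fst := by simp
          rw [this] at hu
          exact hu.left_of_append
        have h2 : ((i :: u.map Prod.fst).reverse).IsChain (· ≠ ·) := by simpa using h1
        exact (List.isChain_reverse.1 h2).imp (fun _ _ h => Ne.symm h)
      have step := ih hw' ((i, ⟨a, ha⟩) :: u) (by simpa using hu)
      rw [List.map_cons, List.prod_cons, map_mul, hρ]
      change actFun hψ i a _ u = _
      rw [actFun_of_chain hψ i a _ u hiu, appendFun, ha, hc, zero_mul, add_zero, step]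
      simp; ring
  refine ⟨Φ, ?_, fun w hw => ?_⟩
  · have := key [] ⟨by simp, by simp⟩ [] (by simp)
    simp only [List.map_nil, List.prod_nil, mul_one] at this
    exact this
  · have := key w hw [] (by simpa using hw.2)
    simp only [List.map_nil, List.prod_nil, one_mul] at this
    exact this

/-- The free product is generated by the copies. -/
theorem freePower_induction (T : Subalgebra ℂ (FreePower A)) (h : ∀ i a, copy i a ∈ T)
    (x : FreePower A) : x ∈ T := by
  let g : FreePower A →ₐ[ℂ] T := FreeProduct.lift ℂ (fun _ : ℕ => A)
    (fun {i} => (copy i).codRestrict T (h i))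
  have hg : ∀ i a, (g (copy i a) : FreePower A) = copy i a := fun i a => by
    have := FreeProduct.lift_comp_ι (I := ℕ) ℂ (fun _ : ℕ => A)
      (fun {i} => (copy i).codRestrict T (h i)) (i := i)
    exact congrArg (fun f => ((f a : T) : FreePower A)) this
  have : T.val.comp g = AlgHom.id ℂ _ := by
    apply (FreeProduct.lift ℂ (fun _ : ℕ => A)).symm.injective
    funext i
    exact AlgHom.ext fun a => hg i a
  have hx := congrArg (fun f => f x) this
  simp only [AlgHom.comp_apply, AlgHom.id_apply] at hx
  rw [← hx]
  exact (g x).2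

theorem span_words (hψ : ψ 1 = 1) : Submodule.span ℂ
    {x : FreePower A | ∃ w, IsCentredAlternating ψ w ∧ x = (w.map fun p => copy p.1 p.2).prod}
      = ⊤ := by
  set S := Submodule.span ℂ
    {x : FreePower A | ∃ w, IsCentredAlternating ψ w ∧ x = (w.map fun p => copy p.1 p.2).prod}
  have h1 : (1 : FreePower A) ∈ S :=
    Submodule.subset_span ⟨[], ⟨by simp, by simp⟩, by simp⟩
  have hw : ∀ i a (w : List (ℕ × A)), (∀ p ∈ w, ψ p.2 = 0) →
      (i :: w.map Prod.fst).IsChain (· ≠ ·) →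
      copy i a * (w.map fun p => copy p.1 p.2).prod ∈ S := by
    intro i a w hw hc
    have e : copy i a * (w.map fun p => copy p.1 p.2).prod
        = (((i, a - ψ a • (1 : A)) :: w).map fun p => copy p.1 p.2).prod
          + ψ a • (w.map fun p => copy p.1 p.2).prod := by
      have e1 : copy i a = copy i (a - ψ a • (1 : A)) + ψ a • 1 := by
        rw [← map_one (copy i), ← map_smul, ← map_add, sub_add_cancel]
      rw [List.map_cons, List.prod_cons, ← smul_one_mul (ψ a) (List.prod _), ← add_mul, ← e1]
    rw [e]
    refine add_mem (Submodule.subset_span ⟨(i, a - ψ a • (1 : A)) :: w, ⟨?_, hc⟩, rfl⟩)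
      (Submodule.smul_mem _ _ (Submodule.subset_span ⟨_, ⟨hw, hc.tail⟩, rfl⟩))
    intro p hp
    rcases List.mem_cons.1 hp with rfl | hp
    · simp [hψ]
    · exact hw p hp
  let T : Subalgebra ℂ (FreePower A) :=
    { carrier := {x | ∀ y ∈ S, x * y ∈ S}
      mul_mem' := fun {x y} hx hy z hz => by rw [mul_assoc]; exact hx _ (hy z hz)
      add_mem' := fun {x y} hx hy z hz => by rw [add_mul]; exact add_mem (hx z hz) (hy z hz)
      algebraMap_mem' := fun c z hz => by
        rw [← Algebra.smul_def]; exact Submodule.smul_mem _ _ hz }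
  refine eq_top_iff.2 fun x _ => ?_
  have hx : x ∈ T := freePower_induction T (fun i a => by
    intro y hy
    induction hy using Submodule.span_induction with
    | mem y hy =>
      obtain ⟨w, hwc, rfl⟩ := hy
      cases w with
      | nil => exact hw i a [] (by simp) (by simp)
      | cons p w =>
        obtain ⟨j, b⟩ := p
        by_cases hj : j = i
        · subst hj
          rw [List.map_cons, List.prod_cons, ← mul_assoc, ← map_mul]
          exact hw j (a * b) w (fun p hp => hwc.1 p (by simp [hp])) hwc.2
        · exact hw i a _ hwc.1 (by
            rw [List.map_cons, List.isChain_cons_cons]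
            exact ⟨Ne.symm hj, hwc.2⟩)
    | zero => simp
    | add x y _ _ hx hy => rw [mul_add]; exact add_mem hx hy
    | smul c x _ hx => rw [mul_smul_comm]; exact Submodule.smul_mem _ _ hx) x
  simpa using hx 1 h1

theorem IsCondFreeState.unique {φ : A →ₗ[ℂ] ℂ} (hψ : ψ 1 = 1) {Φ Φ' : FreePower A →ₗ[ℂ] ℂ}
    (h : IsCondFreeState φ ψ Φ) (h' : IsCondFreeState φ ψ Φ') : Φ = Φ' := by
  refine LinearMap.ext_on (span_words hψ) ?_
  rintro _ ⟨w, hw, rfl⟩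
  rw [h.2 w hw, h'.2 w hw]

theorem isFreeState_iff {Ψ : FreePower A →ₗ[ℂ] ℂ} :
    IsFreeState ψ Ψ ↔ IsCondFreeState ψ ψ Ψ := by
  refine and_congr_right fun h1 => forall_congr' fun w => ?_
  cases w with
  | nil => simp [h1]
  | cons p w =>
    refine ⟨fun h hw => ?_, fun h _ hw => ?_⟩
    · rw [h (by simp) hw, List.map_cons, List.prod_cons, hw.1 p (by simp), zero_mul]
    · rw [h hw, List.map_cons, List.prod_cons, hw.1 p (by simp), zero_mul]

end Existence

/-- Existence and uniqueness of the conditionally free product state. -/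
theorem existsUnique_condFreeState (φ ψ : A →ₗ[ℂ] ℂ) (hψ : ψ 1 = 1) :
    ∃! Φ : FreePower A →ₗ[ℂ] ℂ, IsCondFreeState φ ψ Φ := by
  obtain ⟨Φ, h⟩ := exists_condFreeState φ hψ
  exact ⟨Φ, h, fun Φ' h' => h'.unique hψ h⟩

/-- Existence and uniqueness of the free product state. -/
theorem existsUnique_freeState (ψ : A →ₗ[ℂ] ℂ) (hψ : ψ 1 = 1) :
    ∃! Ψ : FreePower A →ₗ[ℂ] ℂ, IsFreeState ψ Ψ := by
  simpa only [isFreeState_iff] using existsUnique_condFreeState ψ ψ hψ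

/-- The free product state on the free product of infinitely many copies of `(A, ψ)`. -/
noncomputable def freeState (ψ : A →ₗ[ℂ] ℂ) (hψ : ψ 1 = 1) : FreePower A →ₗ[ℂ] ℂ :=
  (existsUnique_freeState ψ hψ).choose

theorem isFreeState_freeState (ψ : A →ₗ[ℂ] ℂ) (hψ : ψ 1 = 1) : IsFreeState ψ (freeState ψ hψ) :=
  (existsUnique_freeState ψ hψ).choose_spec.1

/-- The functional `Φ` of the conditionally free product of infinitely many copies of
`(A, φ, ψ)`. -/
noncomputable def condFreeState (φ ψ : A →ₗ[ℂ] ℂ) (hψ : ψ 1 = 1) : FreePower A →ₗ[ℂ] ℂ :=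
  (existsUnique_condFreeState φ ψ hψ).choose

theorem isCondFreeState_condFreeState (φ ψ : A →ₗ[ℂ] ℂ) (hψ : ψ 1 = 1) :
    IsCondFreeState φ ψ (condFreeState φ ψ hψ) :=
  (existsUnique_condFreeState φ ψ hψ).choose_spec.1

theorem copy_injective (k : ℕ) : Function.Injective (copy (A := A) k) := by
  have h := FreeProduct.lift_comp_ι (I := ℕ) ℂ (fun _ : ℕ => A)
    (fun {_} => AlgHom.id ℂ A) (i := k)
  exact Function.LeftInverse.injective (g := FreeProduct.lift ℂ (fun _ : ℕ => A)
    (fun {_} => AlgHom.id ℂ A)) fun a => congrArg (fun f => f a) h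

theorem IsCondFreeState.copy_apply {φ ψ : A →ₗ[ℂ] ℂ} (hφ : φ 1 = 1) (hψ : ψ 1 = 1)
    {Φ : FreePower A →ₗ[ℂ] ℂ} (h : IsCondFreeState φ ψ Φ) (k : ℕ) (a : A) :
    Φ (copy k a) = φ a := by
  have h1 := h.2 [(k, a - ψ a • 1)] ⟨by simp [hψ], by simp⟩
  have e : copy k a = copy k (a - ψ a • 1) + ψ a • (1 : FreePower A) := by
    rw [← map_one (copy k), ← map_smul, ← map_add]; simp
  simp only [List.map_cons, List.map_nil, List.prod_cons, List.prod_nil, mul_one] at h1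
  rw [e, map_add, h1, map_smul, h.1]
  simp [hφ]

theorem IsCondFreeState.interchangeable {φ ψ : A →ₗ[ℂ] ℂ} (hψ : ψ 1 = 1)
    {Φ : FreePower A →ₗ[ℂ] ℂ} (hΦ : IsCondFreeState φ ψ Φ) (n : ℕ) (X : Fin n → A)
    (h : Fin n → ℕ) (σ : Equiv.Perm ℕ) :
    Φ (List.ofFn fun j => copy (h j) (X j)).prod
      = Φ (List.ofFn fun j => copy (σ (h j)) (X j)).prod := by
  let α : FreePower A →ₐ[ℂ] FreePower A :=
    FreeProduct.lift ℂ (fun _ : ℕ => A) (fun {i} => copy (σ i))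
  have hα : ∀ i a, α (copy i a) = copy (σ i) a := fun i a => by
    have := FreeProduct.lift_comp_ι (I := ℕ) ℂ (fun _ : ℕ => A) (fun {i} => copy (σ i)) (i := i)
    exact congrArg (fun f => f a) this
  have hΦα : IsCondFreeState φ ψ (Φ ∘ₗ α.toLinearMap) := by
    refine ⟨by simp [hΦ.1], fun w hw => ?_⟩
    have := hΦ.2 (w.map fun p => (σ p.1, p.2)) ⟨fun p hp => ?_, ?_⟩
    · rw [List.map_map, List.map_map] at this
      rw [LinearMap.comp_apply, AlgHom.toLinearMap_apply, map_list_prod, List.map_map]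
      have e : (⇑α ∘ fun p : ℕ × A => copy p.1 p.2)
          = (fun p : ℕ × A => copy p.1 p.2) ∘ fun p => (σ p.1, p.2) := funext fun p => hα _ _
      rw [e]
      exact this
    · obtain ⟨q, hq, rfl⟩ := List.mem_map.1 hp
      exact hw.1 q hq
    · have h2 := hw.2
      rw [List.map_map]
      rw [List.isChain_map] at h2 ⊢
      exact h2.imp fun a b hab => σ.injective.ne hab
  have := congrArg (fun f => f (List.ofFn fun j => copy (h j) (X j)).prod) (hΦα.unique hψ hΦ)
  simp only [LinearMap.comp_apply, AlgHom.toLinearMap_apply, map_list_prod, List.map_ofFn] at this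
  rw [← this]
  congr 3
  funext j; exact hα _ _

/-- The exchangeability system for `(A, φ)` given by the conditionally free product of infinitely
many copies of `(A, φ, ψ)`. -/
noncomputable def condFreeSystem (φ ψ : A →ₗ[ℂ] ℂ) (hφ : φ 1 = 1) (hψ : ψ 1 = 1) :
    ExchangeabilitySystem φ where
  U := FreePower A
  state := condFreeState φ ψ hψ
  state_one := (isCondFreeState_condFreeState φ ψ hψ).1
  ι := copy
  ι_injective := copy_injective
  state_ι := (isCondFreeState_condFreeState φ ψ hψ).copy_apply hφ hψ
  interchangeable := (isCondFreeState_condFreeState φ ψ hψ).interchangeable hψ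

/-- The exchangeability system for `(A, ψ)` given by the free product of infinitely many copies
of `(A, ψ)`. -/
noncomputable def freeSystem (ψ : A →ₗ[ℂ] ℂ) (hψ : ψ 1 = 1) : ExchangeabilitySystem ψ where
  U := FreePower A
  state := freeState ψ hψ
  state_one := (isFreeState_freeState ψ hψ).1
  ι := copy
  ι_injective := copy_injective
  state_ι := (isFreeState_iff.1 (isFreeState_freeState ψ hψ)).copy_apply hψ hψ
  interchangeable := (isFreeState_iff.1 (isFreeState_freeState ψ hψ)).interchangeable hψ

end CFree

/-!
Partitioned cumulants are Möbius transforms of partitioned moments, so the identities for cumulants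
are obtained by writing down a function on partitions whose sums over `τ ≤ σ` are the moments `φ_σ`
and invoking uniqueness (`CFree.mobius_eq`). Three consequences are used throughout: a product of a
function of `σ|_S` and a function of `σ|_{Sᶜ}` has a Möbius transform which factorizes if `S` is a
union of blocks and vanishes otherwise (`CFree.mobius_split`); a function of `σ ⊓ θ` has a Möbius
transform supported below `θ` (`CFree.mobius_eq_zero_of_inf`); and if `f` vanishes between `ε` and
`π`, then its transforms at the `τ ≤ π` with `τ ⊔ ε = π` add up to zero
(`CFree.sum_mobius_sup_eq_zero`).

*Crossing partitions* (`CFree.condFreeSystem_cumulant_eq_zero`). Induct on the number of points and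
on refinement. Suppose first that some `j` and `j + 1` lie in one block of the crossing partition
`π`. Multiplying `X_j` and `X_{j+1}` and putting a unit in place of `X_{j+1}` changes no moment
`φ_σ` with `j ∼ j + 1` in `σ`, and makes `K_π` vanish because a unit sits in a block which is not a
singleton. Hence `K_π(X)` is a combination of cumulants of partitions `τ < π` which arise by
splitting a block between `j` and `j + 1`; these are still crossing, so they vanish by induction. If no
neighbours lie in one block, each `X_j` is the sum of a centred element and a multiple of the unit.
Units are removed by induction, and for centred arguments all words are alternating, so that
`φ_σ = φ(X₁) ⋯ φ(Xₙ)` for all `σ ≤ π`; the Möbius transform of a constant vanishes at `π ≠ ⊥`.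

*Factorization.* If `π` is crossing, then one of its two parts is crossing and both sides vanish.
Otherwise the outer component is a single block `B`. For a word `w` sharing no index with `p` and
`q`, `Φ(p w q) = Ψ(w) Φ(p q) + (Φ(w) - Ψ(w)) Φ(p) Φ(q)` (`CFree.IsCondFreeState.apply_mul_mul`). The
second term does not see whether `p` and `q` are connected, so it does not contribute to the
cumulant if some block joins `p` to `q`; it is zero if `φ = ψ`. Thus the gaps of `B` can be split
off one by one as free cumulants, and in the same way the free cumulant of the inner part is the product
of those of the gaps (`CFree.condFreeSystem_cumulant_of_enclosing`).
-/

namespace CFree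

universe u

/-! ### Möbius transforms on the lattice of partitions -/

open Classical in
/-- The Möbius transform `π ↦ ∑_{σ ≤ π} f(σ) μ(σ, π)` of a function on partitions. -/
noncomputable def mobius {n : ℕ} (f : Setoid (Fin n) → ℂ) (π : Setoid (Fin n)) : ℂ :=
  ∑ σ ∈ Finset.Iic π, f σ * IncidenceAlgebra.mu ℂ σ π

/-- Möbius inversion. -/
theorem sum_mobius {n : ℕ} (f : Setoid (Fin n) → ℂ) (π : Setoid (Fin n)) :
    ∑ σ ∈ Finset.Iic π, mobius f σ = f π := by
  classical
  -- exchange the sums and use `∑_{τ ≤ σ ≤ π} μ(τ, σ) = δ_{τπ}`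
  have h : ∀ σ ∈ Finset.Iic π, mobius f σ
      = ∑ τ ∈ Finset.Iic π, if τ ≤ σ then f τ * IncidenceAlgebra.mu ℂ τ σ else 0 := by
    intro σ hσ
    rw [mobius, ← Finset.sum_filter]
    refine Finset.sum_congr ?_ fun _ _ => rfl
    ext τ
    simp only [Finset.mem_filter, Finset.mem_Iic] at hσ ⊢
    exact ⟨fun h => ⟨h.trans hσ, h⟩, fun h => h.2⟩
  rw [Finset.sum_congr rfl h, Finset.sum_comm]
  have h2 : ∀ τ ∈ Finset.Iic π,
      (∑ σ ∈ Finset.Iic π, if τ ≤ σ then f τ * IncidenceAlgebra.mu ℂ τ σ else 0)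
        = f τ * if τ = π then 1 else 0 := by
    intro τ _
    rw [← IncidenceAlgebra.sum_Icc_mu_right τ π, Finset.mul_sum, ← Finset.sum_filter]
    refine Finset.sum_congr ?_ fun _ _ => rfl
    ext σ
    simp [and_comm]
  rw [Finset.sum_congr rfl h2]
  simp

/-- Uniqueness in the Möbius inversion formula, on the principal ideal generated by `π`. -/
theorem mobius_eq {n : ℕ} {f g : Setoid (Fin n) → ℂ} {π : Setoid (Fin n)}
    (h : ∀ σ ≤ π, ∑ τ ∈ Finset.Iic σ, g τ = f σ) : mobius f π = g π := by
  classical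
  induction π using WellFoundedLT.induction with
  | ind π ih =>
  have h1 := h π le_rfl
  rw [← sum_mobius f π, ← Finset.Iio_insert, Finset.sum_insert (by simp),
    Finset.sum_insert (by simp)] at h1
  have h2 : ∑ τ ∈ Finset.Iio π, g τ = ∑ τ ∈ Finset.Iio π, mobius f τ :=
    Finset.sum_congr rfl fun τ hτ =>
      (ih τ (Finset.mem_Iio.1 hτ) fun σ hσ => h σ (hσ.trans (Finset.mem_Iio.1 hτ).le)).symm
  rw [h2] at h1
  exact (add_right_cancel h1).symm

theorem mobius_congr {n : ℕ} {f g : Setoid (Fin n) → ℂ} {π : Setoid (Fin n)}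
    (h : ∀ σ ≤ π, f σ = g σ) : mobius f π = mobius g π :=
  mobius_eq fun σ hσ => by rw [sum_mobius, h σ hσ]

theorem mobius_add {n : ℕ} (f g : Setoid (Fin n) → ℂ) (π : Setoid (Fin n)) :
    mobius (fun σ => f σ + g σ) π = mobius f π + mobius g π := by
  simp only [mobius, add_mul, Finset.sum_add_distrib]

theorem mobius_sub {n : ℕ} (f g : Setoid (Fin n) → ℂ) (π : Setoid (Fin n)) :
    mobius (fun σ => f σ - g σ) π = mobius f π - mobius g π := by
  simp only [mobius, sub_mul, Finset.sum_sub_distrib]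

theorem mobius_const_mul {n : ℕ} (c : ℂ) (f : Setoid (Fin n) → ℂ) (π : Setoid (Fin n)) :
    mobius (fun σ => c * f σ) π = c * mobius f π := by
  simp only [mobius, mul_assoc, Finset.mul_sum]

/-- If `f` only depends on the meet with `θ`, its Möbius transform is supported below `θ`. -/
theorem mobius_eq_zero_of_inf {n : ℕ} {f : Setoid (Fin n) → ℂ} {π θ : Setoid (Fin n)}
    (h : ∀ σ ≤ π, f σ = f (σ ⊓ θ)) (hπ : ¬ π ≤ θ) : mobius f π = 0 := by
  classical
  rw [mobius_eq (g := fun τ => if τ ≤ θ then mobius f τ else 0), if_neg hπ]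
  intro σ hσ
  rw [h σ hσ, ← sum_mobius f (σ ⊓ θ), ← Finset.sum_filter]
  refine Finset.sum_congr ?_ fun _ _ => rfl
  ext τ
  simp

/-- If `f` vanishes on all partitions between `ε` and `π`, its Möbius transforms at the
`τ ≤ π` with `τ ⊔ ε = π` add up to zero. -/
theorem sum_mobius_sup_eq_zero {n : ℕ} {f : Setoid (Fin n) → ℂ} {π ε : Setoid (Fin n)}
    (hε : ε ≤ π) (h : ∀ σ ≤ π, ε ≤ σ → f σ = 0) [DecidableEq (Setoid (Fin n))] :
    ∑ τ ∈ Finset.Iic π with τ ⊔ ε = π, mobius f τ = 0 := by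
  classical
  induction π using WellFoundedLT.induction with
  | ind π ih =>
  have h1 := h π le_rfl hε
  rw [← sum_mobius f π, ← Finset.sum_fiberwise_of_maps_to
    (t := Finset.Iic π) (g := fun τ => τ ⊔ ε)
    (fun τ hτ => by simpa using ⟨Finset.mem_Iic.1 hτ, hε⟩)] at h1
  rw [Finset.sum_eq_single π] at h1
  · convert h1
  · intro ρ hρ hne
    have hρ := Finset.mem_Iic.1 hρ
    by_cases hερ : ε ≤ ρ
    · rw [← ih ρ (lt_of_le_of_ne hρ hne) hερ fun σ hσ => h σ (hσ.trans hρ)]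
      refine Finset.sum_congr ?_ fun _ _ => rfl
      ext τ
      simp only [Finset.mem_filter, Finset.mem_Iic]
      exact ⟨fun h => ⟨h.2 ▸ le_sup_left, h.2⟩, fun h => ⟨h.1.trans hρ, h.2⟩⟩
    · refine Finset.sum_eq_zero fun τ hτ => (hερ ?_).elim
      rw [← (Finset.mem_filter.1 hτ).2]
      exact le_sup_right
  · simp

theorem mobius_const {n : ℕ} (c : ℂ) {π : Setoid (Fin n)} (hπ : π ≠ ⊥) :
    mobius (fun _ => c) π = 0 :=
  mobius_eq_zero_of_inf (θ := ⊥) (fun _ _ => rfl) (by simpa using hπ)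

/-! ### Restriction of partitions to a union of blocks -/

/-- `S` is a union of blocks of `π`. -/
def IsSaturated {n : ℕ} (π : Setoid (Fin n)) (S : Finset (Fin n)) : Prop :=
  ∀ x y, π x y → x ∈ S → y ∈ S

theorem IsSaturated.mono {n : ℕ} {π σ : Setoid (Fin n)} {S : Finset (Fin n)}
    (h : IsSaturated π S) (hσ : σ ≤ π) : IsSaturated σ S :=
  fun x y hxy => h x y (hσ hxy)

/-- The renumbering of `[n]` listing first the elements of `S` and then those of its
complement. -/
def splitEquiv {n : ℕ} (S : Finset (Fin n)) : Fin S.card ⊕ Fin Sᶜ.card ≃ Fin n :=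
  finSumEquivOfFinset rfl rfl

/-- The partition of `[n]` composed of a partition of `S` and a partition of the complement. -/
def glue {n : ℕ} (S : Finset (Fin n)) (σ : Setoid (Fin S.card)) (τ : Setoid (Fin Sᶜ.card)) :
    Setoid (Fin n) :=
  Setoid.ker (Sum.map (Quotient.mk σ) (Quotient.mk τ) ∘ (splitEquiv S).symm)

section glue

variable {n : ℕ} (S : Finset (Fin n)) (σ : Setoid (Fin S.card)) (τ : Setoid (Fin Sᶜ.card))

theorem splitEquiv_inl_mem (i : Fin S.card) : splitEquiv S (Sum.inl i) ∈ S := by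
  simp [splitEquiv]

theorem splitEquiv_inr_notMem (i : Fin Sᶜ.card) : splitEquiv S (Sum.inr i) ∉ S := by
  have : splitEquiv S (Sum.inr i) ∈ Sᶜ := by
    rw [splitEquiv, finSumEquivOfFinset_inr]; exact Finset.orderEmbOfFin_mem _ _ _
  simpa using this

theorem restrict_apply (π : Setoid (Fin n)) (i j : Fin S.card) :
    restrict π S i j ↔ π (splitEquiv S (Sum.inl i)) (splitEquiv S (Sum.inl j)) := by
  simp only [splitEquiv, finSumEquivOfFinset_inl]; rfl

theorem restrict_compl_apply (π : Setoid (Fin n)) (i j : Fin Sᶜ.card) :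
    restrict π Sᶜ i j ↔ π (splitEquiv S (Sum.inr i)) (splitEquiv S (Sum.inr j)) := by
  simp only [splitEquiv, finSumEquivOfFinset_inr]; rfl

theorem glue_inl_inl (i j : Fin S.card) :
    glue S σ τ (splitEquiv S (Sum.inl i)) (splitEquiv S (Sum.inl j)) ↔ σ i j := by
  rw [glue, Setoid.ker_def]; simp [Quotient.eq]

theorem glue_inr_inr (i j : Fin Sᶜ.card) :
    glue S σ τ (splitEquiv S (Sum.inr i)) (splitEquiv S (Sum.inr j)) ↔ τ i j := by
  rw [glue, Setoid.ker_def]; simp [Quotient.eq]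

theorem not_glue_inl_inr (i : Fin S.card) (j : Fin Sᶜ.card) :
    ¬ glue S σ τ (splitEquiv S (Sum.inl i)) (splitEquiv S (Sum.inr j)) := by
  rw [glue, Setoid.ker_def]; simp

theorem isSaturated_glue : IsSaturated (glue S σ τ) S := by
  intro x y hxy hx
  obtain ⟨x, rfl⟩ := (splitEquiv S).surjective x
  obtain ⟨y, rfl⟩ := (splitEquiv S).surjective y
  rcases x with x | x
  · rcases y with y | y
    · exact splitEquiv_inl_mem S y
    · exact (not_glue_inl_inr S σ τ x y hxy).elim
  · exact (splitEquiv_inr_notMem S x hx).elim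

theorem restrict_glue : restrict (glue S σ τ) S = σ :=
  Setoid.ext fun i j => by rw [restrict_apply, glue_inl_inl]

theorem restrict_compl_glue : restrict (glue S σ τ) Sᶜ = τ :=
  Setoid.ext fun i j => by rw [restrict_compl_apply, glue_inr_inr]

variable {S}

theorem le_of_restrict_le {π ρ : Setoid (Fin n)} (hπ : IsSaturated π S)
    (h1 : restrict π S ≤ restrict ρ S) (h2 : restrict π Sᶜ ≤ restrict ρ Sᶜ) : π ≤ ρ := by
  intro x y hxy
  have hyx := hπ y x (π.symm' hxy)
  have hxy' := hπ x y hxy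
  obtain ⟨x, rfl⟩ := (splitEquiv S).surjective x
  obtain ⟨y, rfl⟩ := (splitEquiv S).surjective y
  rcases x with x | x <;> rcases y with y | y
  · exact (restrict_apply S ρ x y).1 (h1 ((restrict_apply S π x y).2 hxy))
  · exact (splitEquiv_inr_notMem S y (hxy' (splitEquiv_inl_mem S x))).elim
  · exact (splitEquiv_inr_notMem S x (hyx (splitEquiv_inl_mem S y))).elim
  · exact (restrict_compl_apply S ρ x y).1 (h2 ((restrict_compl_apply S π x y).2 hxy))

theorem restrict_mono {π ρ : Setoid (Fin n)} (h : π ≤ ρ) (T : Finset (Fin n)) :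
    restrict π T ≤ restrict ρ T := fun _ _ hij => h hij

theorem glue_restrict {π : Setoid (Fin n)} (hπ : IsSaturated π S) :
    glue S (restrict π S) (restrict π Sᶜ) = π :=
  le_antisymm
    (le_of_restrict_le (isSaturated_glue S _ _) (restrict_glue ..).le (restrict_compl_glue ..).le)
    (le_of_restrict_le hπ (restrict_glue ..).ge (restrict_compl_glue ..).ge)

end glue

/-- The partitions below `π` for which `S` is a union of blocks are the pairs of a partition
below `π|_S` and one below `π|_{Sᶜ}`. -/
theorem sum_saturated {n : ℕ} (S : Finset (Fin n)) (π : Setoid (Fin n))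
    (f : Setoid (Fin S.card) → ℂ) (g : Setoid (Fin Sᶜ.card) → ℂ)
    [DecidablePred fun τ : Setoid (Fin n) => IsSaturated τ S] :
    ∑ τ ∈ Finset.Iic π, (if IsSaturated τ S then f (restrict τ S) * g (restrict τ Sᶜ) else 0)
      = (∑ σ ∈ Finset.Iic (restrict π S), f σ) * ∑ σ ∈ Finset.Iic (restrict π Sᶜ), g σ := by
  rw [Finset.sum_mul_sum, ← Finset.sum_product', ← Finset.sum_filter]
  refine Finset.sum_nbij' (fun τ => (restrict τ S, restrict τ Sᶜ)) (fun p => glue S p.1 p.2)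
    ?_ ?_ ?_ ?_ ?_
  · intro τ hτ
    simp only [Finset.mem_filter, Finset.mem_Iic, Finset.mem_product] at hτ ⊢
    exact ⟨restrict_mono hτ.1 _, restrict_mono hτ.1 _⟩
  · intro p hp
    simp only [Finset.mem_filter, Finset.mem_Iic, Finset.mem_product] at hp ⊢
    refine ⟨le_of_restrict_le (isSaturated_glue S _ _) ?_ ?_, isSaturated_glue S _ _⟩
    · rw [restrict_glue]; exact hp.1
    · rw [restrict_compl_glue]; exact hp.2
  · intro τ hτ
    exact glue_restrict (Finset.mem_filter.1 hτ).2
  · intro p _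
    exact Prod.ext (restrict_glue ..) (restrict_compl_glue ..)
  · intro τ _
    rfl

open Classical in
/-- The Möbius transform of a product of a function of `σ|_S` and a function of `σ|_{Sᶜ}`
vanishes where `S` is not a union of blocks, and factorizes where it is. -/
theorem mobius_split {n : ℕ} {S : Finset (Fin n)} {π : Setoid (Fin n)}
    {f : Setoid (Fin n) → ℂ} {f₁ : Setoid (Fin S.card) → ℂ} {f₂ : Setoid (Fin Sᶜ.card) → ℂ}
    (h : ∀ σ ≤ π, f σ = f₁ (restrict σ S) * f₂ (restrict σ Sᶜ)) :
    mobius f π = if IsSaturated π S then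
      mobius f₁ (restrict π S) * mobius f₂ (restrict π Sᶜ) else 0 :=
  mobius_eq (g := fun τ => if IsSaturated τ S then
      mobius f₁ (restrict τ S) * mobius f₂ (restrict τ Sᶜ) else 0) fun σ hσ => by
    rw [sum_saturated, sum_mobius, sum_mobius, h σ hσ]

/-! ### Moments and cumulants of a general exchangeability system -/

theorem sort_eq_filter {n : ℕ} (S : Finset (Fin n)) :
    S.sort = (List.finRange n).filter (· ∈ S) := by
  refine List.Perm.eq_of_sortedLE (Finset.sortedLT_sort S).sortedLE
    ((List.sortedLT_finRange n).pairwise.filter _).sortedLT.sortedLE ?_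
  refine (List.perm_ext_iff_of_nodup (Finset.sort_nodup _ _)
    ((List.nodup_finRange n).filter _)).2 fun x => ?_
  simp

theorem prod_map_filter_of_eq_one {α M : Type*} [Monoid M] (f : α → M) (p : α → Bool)
    (l : List α) (h : ∀ x, p x = false → f x = 1) :
    ((l.filter p).map f).prod = (l.map f).prod := by
  induction l with
  | nil => rfl
  | cons x l ih =>
    by_cases hx : p x
    · simp [hx, ih]
    · simp [hx, ih, h x (by simpa using hx)]

theorem finRange_eq_append {n : ℕ} {j j' : Fin n} (hj : (j' : ℕ) = j + 1) :
    List.finRange n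
      = (List.finRange n).take j ++ j :: j' :: (List.finRange n).drop (j + 2) := by
  have h1 : (j : ℕ) < (List.finRange n).length := by simp
  have h2 : (j : ℕ) + 1 < (List.finRange n).length := by simp [← hj]
  conv_lhs => rw [← List.take_append_drop j (List.finRange n), List.drop_eq_getElem_cons h1,
    List.drop_eq_getElem_cons h2]
  have := j'.isLt
  simp [← hj]
  omega

namespace ExchangeabilitySystem

variable {A : Type u} [Ring A] [Algebra ℂ A] {φ : A →ₗ[ℂ] ℂ} (E : ExchangeabilitySystem φ)

theorem cumulant_eq_mobius {n : ℕ} (π : Setoid (Fin n)) (X : Fin n → A) :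
    E.cumulant π X = mobius (fun σ => E.moment σ X) π := rfl

/-- The moments of a subfamily, computed with an index map of the whole family. -/
theorem moment_restrict {n : ℕ} (σ : Setoid (Fin n)) (X : Fin n → A) (S : Finset (Fin n))
    (h : Fin n → ℕ) (hh : Setoid.ker h = σ) :
    E.moment (restrict σ S) (subfamily X S)
      = E.state (S.sort.map fun j => E.ι (h j) (X j)).prod := by
  rw [E.moment_eq _ _ (h ∘ S.orderEmbOfFin rfl) (by subst hh; rfl),
    ← Finset.listMap_orderEmbOfFin_finRange S rfl, List.map_map, List.ofFn_eq_map]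
  rfl

/-- The cumulant of a subfamily, indexed by any order embedding with the given range. -/
theorem cumulant_comap {n k : ℕ} (π : Setoid (Fin n)) (X : Fin n → A) (S : Finset (Fin n))
    (e : Fin k ↪o Fin n) (he : Finset.univ.map e.toEmbedding = S) :
    E.cumulant (Setoid.comap e π) (X ∘ e) = E.cumulant (restrict π S) (subfamily X S) := by
  obtain rfl : S.card = k := by rw [← he]; simp
  have : e = S.orderEmbOfFin rfl := Finset.orderEmbOfFin_unique' rfl fun x => by
    exact (Finset.ext_iff.1 he _).1 (by simp)
  rw [this]; rfl

/-- Restriction to a subset of a subset. -/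
theorem cumulant_restrict_restrict {n : ℕ} (π : Setoid (Fin n)) (X : Fin n → A)
    (S : Finset (Fin n)) (T : Finset (Fin S.card)) :
    E.cumulant (restrict (restrict π S) T) (subfamily (subfamily X S) T)
      = E.cumulant (restrict π (T.map (S.orderEmbOfFin rfl).toEmbedding))
        (subfamily X (T.map (S.orderEmbOfFin rfl).toEmbedding)) := by
  refine E.cumulant_comap π X _ ((T.orderEmbOfFin rfl).trans (S.orderEmbOfFin rfl)) ?_
  conv_rhs => rw [← Finset.map_orderEmbOfFin_univ T rfl, Finset.map_map]
  rfl

theorem cumulant_restrict_univ {n : ℕ} (π : Setoid (Fin n)) (X : Fin n → A) :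
    E.cumulant (restrict π Finset.univ) (subfamily X Finset.univ) = E.cumulant π X :=
  (E.cumulant_comap π X Finset.univ (RelEmbedding.refl _) (by ext; simp)).symm

theorem cumulant_fin_zero {π : Setoid (Fin 0)} (X : Fin 0 → A) : E.cumulant π X = 1 := by
  rw [cumulant_eq_mobius]
  refine mobius_eq (g := fun _ => 1) fun σ _ => ?_
  have h : Finset.Iic σ = {σ} := by
    ext τ
    have : τ = σ := Setoid.ext fun a => a.elim0
    simp [this]
  simp [h, moment, E.state_one]

theorem cumulant_empty {n : ℕ} (π : Setoid (Fin n)) (X : Fin n → A) :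
    E.cumulant (restrict π ∅) (subfamily X ∅) = 1 :=
  E.cumulant_fin_zero _

theorem moment_update {n : ℕ} (σ : Setoid (Fin n)) (X : Fin n → A) (j : Fin n) (a b : A) (c : ℂ) :
    E.moment σ (Function.update X j (a + c • b))
      = E.moment σ (Function.update X j a) + c * E.moment σ (Function.update X j b) := by
  let F := (E.state.compMultilinearMap (MultilinearMap.mkPiAlgebraFin ℂ n E.U)).compLinearMap
    (fun j => (E.ι (blockIndex σ j)).toLinearMap)
  have hF : ∀ Y, E.moment σ Y = F Y := fun Y => rfl
  simp only [hF, MultilinearMap.map_update_add, MultilinearMap.map_update_smul, smul_eq_mul]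

theorem cumulant_update {n : ℕ} (π : Setoid (Fin n)) (X : Fin n → A) (j : Fin n) (a b : A)
    (c : ℂ) : E.cumulant π (Function.update X j (a + c • b))
      = E.cumulant π (Function.update X j a) + c * E.cumulant π (Function.update X j b) := by
  simp only [cumulant_eq_mobius, moment_update, mobius_add, mobius_const_mul]

open Classical in
/-- A unit can only be inserted into a cumulant at a singleton block. -/
theorem cumulant_of_eq_one {n : ℕ} (π : Setoid (Fin n)) (X : Fin n → A) (j : Fin n)
    (hj : X j = 1) : E.cumulant π X = if IsSaturated π {j} then
      E.cumulant (restrict π {j}) (subfamily X {j})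
        * E.cumulant (restrict π {j}ᶜ) (subfamily X {j}ᶜ) else 0 := by
  simp only [cumulant_eq_mobius]
  refine mobius_split fun σ _ => ?_
  rw [E.moment_restrict σ X _ _ (ker_blockIndex σ), E.moment_restrict σ X _ _ (ker_blockIndex σ),
    moment, sort_eq_filter {j}ᶜ, prod_map_filter_of_eq_one, List.ofFn_eq_map]
  · simp [hj, E.state_one]
  · intro x hx
    have : x = j := by simpa using hx
    rw [this, hj, map_one]

/-- Neighbouring factors in the same block can be multiplied. -/
theorem moment_merge {n : ℕ} (σ : Setoid (Fin n)) (X : Fin n → A) {j j' : Fin n}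
    (hj : (j' : ℕ) = j + 1) (h : σ j j') :
    E.moment σ (Function.update (Function.update X j (X j * X j')) j' 1) = E.moment σ X := by
  have hne : j ≠ j' := fun h => by rw [h] at hj; omega
  have hb : blockIndex σ j = blockIndex σ j' := by
    rwa [← Setoid.ker_def (f := blockIndex σ), ker_blockIndex]
  have hnd := List.nodup_finRange n
  rw [finRange_eq_append hj, List.nodup_append] at hnd
  simp only [moment, List.ofFn_eq_map]
  rw [finRange_eq_append hj]
  simp only [List.map_append, List.map_cons, List.prod_append, List.prod_cons]
  congr 2
  · congr 1
    refine List.map_congr_left fun x hx => ?_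
    have h1 := hnd.2.2 x hx j (by simp)
    have h2 := hnd.2.2 x hx j' (by simp)
    simp [h1, h2]
  · have h2 := hnd.2.1
    simp only [List.nodup_cons, List.mem_cons, not_or] at h2
    rw [← mul_assoc, ← mul_assoc]
    congr 1
    · simp [hne, hb]
    · congr 1
      refine List.map_congr_left fun x hx => ?_
      have h3 : x ≠ j := fun h => h2.1.2 (h ▸ hx)
      have h4 : x ≠ j' := fun h => h2.2.1 (h ▸ hx)
      simp [h3, h4]

end ExchangeabilitySystem

/-! ### Crossings -/

section Crossings

variable {n : ℕ}

/-- A crossing whose four points lie in `S` persists in the restriction to `S`. -/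
theorem not_isNoncrossing_restrict {π : Setoid (Fin n)} {S : Finset (Fin n)} {a b c d : Fin n}
    (hab : a < b) (hbc : b < c) (hcd : c < d) (hac : π a c) (hbd : π b d) (hn : ¬ π a b)
    (ha : a ∈ S) (hb : b ∈ S) (hc : c ∈ S) (hd : d ∈ S) : ¬ IsNoncrossing (restrict π S) := by
  have key : ∀ x ∈ S, ∃ i, S.orderEmbOfFin rfl i = x := fun x hx => by
    have : x ∈ Set.range (S.orderEmbOfFin rfl) := by
      rw [Finset.range_orderEmbOfFin]; exact hx
    exact this
  obtain ⟨a, rfl⟩ := key a ha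
  obtain ⟨b, rfl⟩ := key b hb
  obtain ⟨c, rfl⟩ := key c hc
  obtain ⟨d, rfl⟩ := key d hd
  simp only [OrderEmbedding.lt_iff_lt] at hab hbc hcd
  exact not_not.2 ⟨a, b, c, d, hab, hbc, hcd, hac, hbd, hn⟩

/-- The partition whose only nontrivial block is `{j, j'}`. -/
def pairSetoid (j j' : Fin n) : Setoid (Fin n) :=
  Relation.EqvGen.setoid fun x y => x = j ∧ y = j'

theorem pairSetoid_le {j j' : Fin n} {σ : Setoid (Fin n)} : pairSetoid j j' ≤ σ ↔ σ j j' := by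
  constructor
  · exact fun h => h (Relation.EqvGen.rel _ _ ⟨rfl, rfl⟩)
  · intro h
    refine Setoid.eqvGen_le ?_
    rintro x y ⟨rfl, rfl⟩
    exact h

/-- Only the blocks of `j` and `j'` are joined in `τ ⊔ pairSetoid j j'`. -/
theorem sup_pairSetoid {τ : Setoid (Fin n)} {j j' x y : Fin n}
    (h : (τ ⊔ pairSetoid j j') x y) :
    τ x y ∨ ((τ x j ∨ τ x j') ∧ (τ y j ∨ τ y j')) := by
  let ρ : Setoid (Fin n) :=
    { r := fun x y => τ x y ∨ ((τ x j ∨ τ x j') ∧ (τ y j ∨ τ y j'))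
      iseqv :=
        { refl := fun x => Or.inl (τ.refl' x)
          symm := by
            rintro x y (h | h)
            · exact Or.inl (τ.symm' h)
            · exact Or.inr ⟨h.2, h.1⟩
          trans := by
            rintro x y z (h | h) (k | k)
            · exact Or.inl (τ.trans' h k)
            · exact Or.inr ⟨k.1.imp (τ.trans' h) (τ.trans' h), k.2⟩
            · exact Or.inr ⟨h.1, h.2.imp (τ.trans' (τ.symm' k)) (τ.trans' (τ.symm' k))⟩
            · exact Or.inr ⟨h.1, k.2⟩ } }
  have h1 : τ ≤ ρ := fun x y hxy => Or.inl hxy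
  have h2 : pairSetoid j j' ≤ ρ :=
    pairSetoid_le.2 (Or.inr ⟨Or.inl (τ.refl' _), Or.inr (τ.refl' _)⟩)
  exact sup_le h1 h2 h

/-- Splitting a block between two neighbouring points does not remove all crossings: a point
and its neighbour lie on the same side of the other block involved in a crossing, so one of the
two parts still crosses that block. -/
theorem not_isNoncrossing_of_sup_pairSetoid {τ π : Setoid (Fin n)} {j j' : Fin n}
    (hj : (j' : ℕ) = j + 1) (h : τ ⊔ pairSetoid j j' = π) (hπ : ¬ IsNoncrossing π) :
    ¬ IsNoncrossing τ := by
  obtain ⟨a, b, c, d, hab, hbc, hcd, hac, hbd, hn⟩ := not_not.1 hπ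
  have hle : τ ≤ π := h ▸ le_sup_left
  have hjj : π j j' := pairSetoid_le.1 (h ▸ le_sup_right)
  have split : ∀ {x y}, π x y → ¬ τ x y → π x j ∧ ∃ p q : Fin n,
      ((q : ℕ) = p + 1 ∨ (p : ℕ) = q + 1) ∧ τ x p ∧ τ y q := by
    intro x y hxy hτ
    rw [← h] at hxy
    rcases sup_pairSetoid hxy with h1 | ⟨h1 | h1, h2 | h2⟩
    · exact (hτ h1).elim
    · exact (hτ (τ.trans' h1 (τ.symm' h2))).elim
    · exact ⟨hle h1, j, j', Or.inl hj, h1, h2⟩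
    · exact ⟨π.trans' (hle h1) (π.symm' hjj), j', j, Or.inr hj, h1, h2⟩
    · exact (hτ (τ.trans' h1 (τ.symm' h2))).elim
  have mk : ∀ x y z w : Fin n, x < y → y < z → z < w → τ x z → τ y w → ¬ π x y →
      ¬ IsNoncrossing τ := fun x y z w h1 h2 h3 h4 h5 h6 =>
    not_not.2 ⟨x, y, z, w, h1, h2, h3, h4, h5, fun h => h6 (hle h)⟩
  -- at most one of the pairs `a, c` and `b, d` is separated in `τ`; then `p` and `q` are the
  -- neighbours at which its block was split
  by_cases h1 : τ a c
  · by_cases h2 : τ b d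
    · exact mk a b c d hab hbc hcd h1 h2 hn
    · obtain ⟨-, p, q, hpq, hp, hq⟩ := split hbd h2
      have hpa : p ≠ a := by
        rintro rfl; exact hn (π.symm' (hle hp))
      have hpc : p ≠ c := by
        rintro rfl; exact hn (π.trans' hac (π.symm' (hle hp)))
      have hqb : π b q := π.trans' hbd (hle hq)
      have hqa : q ≠ a := by
        rintro rfl; exact hn (π.symm' hqb)
      have hqc : q ≠ c := by
        rintro rfl; exact hn (π.trans' hac (π.symm' hqb))
      have hor : p < a ∨ (a < q ∧ q < c) ∨ c < p := by
        simp only [Fin.lt_def, ne_eq, Fin.ext_iff] at *; omega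
      rcases hor with h3 | ⟨h3, h4⟩ | h3
      · exact mk p a b c h3 hab hbc (τ.symm' hp) h1
          fun h => hn (π.symm' (π.trans' (hle hp) h))
      · exact mk a q c d h3 h4 hcd h1 (τ.symm' hq)
          fun h => hn (π.trans' h (π.symm' hqb))
      · exact mk a b c p hab hbc h3 h1 hp hn
  · obtain ⟨haj, p, q, hpq, hp, hq⟩ := split hac h1
    have h2 : τ b d := by
      by_contra h2
      exact hn (π.trans' haj (π.symm' (split hbd h2).1))
    have hap := hle hp
    have haq := π.trans' hac (hle hq)
    have hnd : ¬ π a d := fun h => hn (π.trans' h (π.symm' hbd))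
    have hpb : p ≠ b := by rintro rfl; exact hn hap
    have hqb : q ≠ b := by rintro rfl; exact hn haq
    have hpd : p ≠ d := by rintro rfl; exact hnd hap
    have hqd : q ≠ d := by rintro rfl; exact hnd haq
    have hor : q < b ∨ (b < p ∧ p < d) ∨ d < q := by
      simp only [Fin.lt_def, ne_eq, Fin.ext_iff] at *; omega
    rcases hor with h3 | ⟨h3, h4⟩ | h3
    · exact mk q b c d h3 hbc hcd (τ.symm' hq) h2 fun h => hn (π.trans' haq h)
    · exact mk a b p d hab h3 h4 hp h2 hn
    · exact mk b c d q hbc hcd h3 h2 hq fun h => hn (π.trans' hac (π.symm' h))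

end Crossings

/-! ### Vanishing of the cumulants of crossing partitions -/

variable {A : Type u} [Ring A] [Algebra ℂ A] {φ ψ : A →ₗ[ℂ] ℂ}

theorem condFreeSystem_moment_of_alternating (hφ : φ 1 = 1) (hψ : ψ 1 = 1) {n : ℕ}
    {σ : Setoid (Fin n)} {X : Fin n → A} (hX : ∀ j, ψ (X j) = 0)
    (hσ : ∀ j j' : Fin n, (j' : ℕ) = j + 1 → ¬ σ j j') :
    (condFreeSystem φ ψ hφ hψ).moment σ X = (List.ofFn fun j => φ (X j)).prod := by
  have h := (isCondFreeState_condFreeState φ ψ hψ).2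
    (List.ofFn fun j => (blockIndex σ j, X j)) ⟨?_, ?_⟩
  · simp only [List.map_ofFn] at h
    exact h
  · simpa [List.mem_ofFn] using hX
  · rw [List.map_ofFn, List.isChain_iff_getElem]
    intro i hi
    simp only [List.length_ofFn] at hi
    simp only [List.getElem_ofFn, Function.comp_apply]
    intro h
    refine hσ ⟨i, by omega⟩ ⟨i + 1, hi⟩ rfl ?_
    exact (ker_blockIndex σ).le h

/-- The cumulants of crossing partitions vanish. Neighbouring points in one block can be
separated at the cost of terms which belong to finer partitions, again crossing. If there are no
such neighbours, all words involved are alternating, and for centred arguments the moments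
`φ_σ`, `σ ≤ π`, all agree; units inserted in place of the arguments reduce the number of
points. -/
theorem condFreeSystem_cumulant_eq_zero (hφ : φ 1 = 1) (hψ : ψ 1 = 1) {n : ℕ}
    (π : Setoid (Fin n)) (hπ : ¬ IsNoncrossing π) (X : Fin n → A) :
    (condFreeSystem φ ψ hφ hψ).cumulant π X = 0 := by
  classical
  induction n using Nat.strong_induction_on with
  | h n ihn =>
  induction π using WellFoundedLT.induction generalizing X with
  | ind π ihπ =>
  set E := condFreeSystem φ ψ hφ hψ
  by_cases hnb : ∃ j j' : Fin n, (j' : ℕ) = j + 1 ∧ π j j'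
  · -- compare with the arguments in which the two neighbours are multiplied
    obtain ⟨j, j', hj, hjj⟩ := hnb
    have hne : j ≠ j' := fun h => by rw [h] at hj; omega
    set X' := Function.update (Function.update X j (X j * X j')) j' 1 with hX'
    have h0 : E.cumulant π X' = 0 := by
      rw [E.cumulant_of_eq_one π X' j' (by simp [hX']), if_neg]
      intro h
      exact hne (by simpa using h j' j (π.symm' hjj) (by simp))
    have h1 := sum_mobius_sup_eq_zero (π := π) (ε := pairSetoid j j')
      (f := fun σ => E.moment σ X - E.moment σ X') (pairSetoid_le.2 hjj) fun σ _ hσ => by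
        rw [hX', E.moment_merge σ X hj (pairSetoid_le.1 hσ), sub_self]
    rw [Finset.sum_eq_single π] at h1
    · rwa [mobius_sub, ← E.cumulant_eq_mobius, ← E.cumulant_eq_mobius, h0, sub_zero] at h1
    · intro τ hτ hτπ
      simp only [Finset.mem_filter, Finset.mem_Iic] at hτ
      have hc := not_isNoncrossing_of_sup_pairSetoid hj hτ.2 hπ
      have hlt := lt_of_le_of_ne hτ.1 hτπ
      rw [mobius_sub, ← E.cumulant_eq_mobius, ← E.cumulant_eq_mobius, ihπ τ hlt hc,
        ihπ τ hlt hc, sub_zero]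
    · intro h
      exact (h (by simpa using pairSetoid_le.2 hjj)).elim
  · -- no neighbours are connected: centre the arguments one at a time, `T` being the set of
    -- positions which still have to be treated
    push Not at hnb
    obtain ⟨a, b, c, d, hab, hbc, hcd, hac, hbd, hn⟩ := not_not.1 hπ
    suffices ∀ (T : Finset (Fin n)) (X : Fin n → A), (∀ j ∉ T, ψ (X j) = 0) →
        E.cumulant π X = 0 from this Finset.univ X (by simp)
    intro T
    induction T using Finset.induction_on with
    | empty =>
      intro X hX
      rw [E.cumulant_eq_mobius, mobius_congr (g := fun _ => (List.ofFn fun j => φ (X j)).prod)]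
      · refine mobius_const _ fun h => (hab.trans hbc).ne ?_
        rw [h] at hac
        exact hac
      · intro σ hσ
        exact condFreeSystem_moment_of_alternating hφ hψ (fun j => hX j (by simp))
          fun j j' hj h => hnb j j' hj (hσ h)
    | insert j T hj ih =>
      intro X hX
      have hunit : E.cumulant π (Function.update X j 1) = 0 := by
        rw [E.cumulant_of_eq_one π _ j (by simp)]
        split_ifs with hs
        · -- the singleton `{j}` takes part in no crossing
          have hne : ∀ x y, x ≠ y → π x y → x ∈ ({j} : Finset (Fin n))ᶜ := by
            intro x y hxy h
            rw [Finset.mem_compl]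
            intro hx
            have hy := hs x y h hx
            rw [Finset.mem_singleton] at hx hy
            exact hxy (hx.trans hy.symm)
          have hac' := (hab.trans hbc).ne
          have hbd' := (hbc.trans hcd).ne
          rw [ihn _ ?_ _ (not_isNoncrossing_restrict hab hbc hcd hac hbd hn (hne a c hac' hac)
            (hne b d hbd' hbd) (hne c a hac'.symm (π.symm' hac))
            (hne d b hbd'.symm (π.symm' hbd))), mul_zero]
          have := j.isLt
          rw [Finset.card_compl, Fintype.card_fin, Finset.card_singleton]
          omega
        · rfl
      have h1 : X = Function.update X j ((X j - ψ (X j) • 1) + ψ (X j) • 1) := by simp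
      rw [h1, E.cumulant_update, hunit, mul_zero, add_zero]
      refine ih _ fun i hi => ?_
      by_cases hij : i = j
      · subst hij
        simp [hψ]
      · rw [Function.update_of_ne hij]
        exact hX i (by simp [hij, hi])

/-! ### Words enclosed by words in other letters -/

/-- The span of the alternating words in centred elements of the copies `A⁽ⁱ⁾`, `i ∈ I`. -/
def wordSpan (ψ : A →ₗ[ℂ] ℂ) (I : Set ℕ) : Submodule ℂ (FreePower A) :=
  Submodule.span ℂ {x | ∃ w : List (ℕ × A), IsCentredAlternating ψ w ∧ (∀ p ∈ w, p.1 ∈ I) ∧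
    x = (w.map fun p => copy p.1 p.2).prod}

theorem copy_mul_mem_wordSpan_of_chain (hψ : ψ 1 = 1) {I : Set ℕ} {i : ℕ} (hi : i ∈ I) (a : A)
    {w : List (ℕ × A)} (hw : ∀ p ∈ w, ψ p.2 = 0) (hwI : ∀ p ∈ w, p.1 ∈ I)
    (hc : (i :: w.map Prod.fst).IsChain (· ≠ ·)) :
    copy i a * (w.map fun p => copy p.1 p.2).prod ∈ wordSpan ψ I := by
  have e : copy i a * (w.map fun p => copy p.1 p.2).prod
      = (((i, a - ψ a • (1 : A)) :: w).map fun p => copy p.1 p.2).prod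
        + ψ a • (w.map fun p => copy p.1 p.2).prod := by
    have e1 : copy i a = copy i (a - ψ a • (1 : A)) + ψ a • 1 := by
      rw [← map_one (copy i), ← map_smul, ← map_add, sub_add_cancel]
    rw [List.map_cons, List.prod_cons, ← smul_one_mul (ψ a) (List.prod _), ← add_mul, ← e1]
  rw [e]
  refine add_mem (Submodule.subset_span ⟨(i, a - ψ a • (1 : A)) :: w, ⟨?_, hc⟩, ?_, rfl⟩)
    (Submodule.smul_mem _ _ (Submodule.subset_span ⟨_, ⟨hw, hc.tail⟩, hwI, rfl⟩))
  · simpa [hψ] using hw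
  · simpa [hi] using hwI

theorem copy_mul_mem_wordSpan (hψ : ψ 1 = 1) {I : Set ℕ} {i : ℕ} (hi : i ∈ I) (a : A)
    {y : FreePower A} (hy : y ∈ wordSpan ψ I) : copy i a * y ∈ wordSpan ψ I := by
  induction hy using Submodule.span_induction with
  | mem y hy =>
    obtain ⟨w, hwc, hwI, rfl⟩ := hy
    cases w with
    | nil => exact copy_mul_mem_wordSpan_of_chain hψ hi a hwc.1 hwI (by simp)
    | cons p w =>
      obtain ⟨j, b⟩ := p
      by_cases hj : j = i
      · subst hj
        rw [List.map_cons, List.prod_cons, ← mul_assoc, ← map_mul]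
        exact copy_mul_mem_wordSpan_of_chain hψ hi (a * b) (fun p hp => hwc.1 p (by simp [hp]))
          (fun p hp => hwI p (by simp [hp])) hwc.2
      · refine copy_mul_mem_wordSpan_of_chain hψ hi a hwc.1 hwI ?_
        rw [List.map_cons, List.isChain_cons_cons]
        exact ⟨Ne.symm hj, hwc.2⟩
  | zero => simp
  | add x y _ _ hx hy => rw [mul_add]; exact add_mem hx hy
  | smul c x _ hx => rw [mul_smul_comm]; exact Submodule.smul_mem _ _ hx

theorem prod_mem_wordSpan (hψ : ψ 1 = 1) {α : Type*} {I : Set ℕ} (h : α → ℕ) (X : α → A)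
    (l : List α) (hl : ∀ x ∈ l, h x ∈ I) :
    (l.map fun x => copy (h x) (X x)).prod ∈ wordSpan ψ I := by
  induction l with
  | nil => exact Submodule.subset_span ⟨[], ⟨by simp, by simp⟩, by simp, by simp⟩
  | cons x l ih =>
    rw [List.map_cons, List.prod_cons]
    exact copy_mul_mem_wordSpan hψ (hl x (by simp)) _ (ih fun y hy => hl y (by simp [hy]))

/-- A word `w` which shares no index with the words `p` and `q` around it may be replaced by
`Ψ(w)`, and the centred remainder disconnects `p` from `q`. -/
theorem IsCondFreeState.apply_mul_mul {Φ Ψ : FreePower A →ₗ[ℂ] ℂ} (hΦ : IsCondFreeState φ ψ Φ)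
    (hΨ : IsFreeState ψ Ψ) {I J : Set ℕ} (hIJ : Disjoint I J) {p w q : FreePower A}
    (hp : p ∈ wordSpan ψ I) (hw : w ∈ wordSpan ψ J) (hq : q ∈ wordSpan ψ I) :
    Φ (p * w * q) = Ψ w * Φ (p * q) + (Φ w - Ψ w) * (Φ p * Φ q) := by
  have hne : ∀ {i j}, i ∈ I → j ∈ J → i ≠ j := fun hi hj h =>
    Set.disjoint_left.1 hIJ hi (h ▸ hj)
  induction hw using Submodule.span_induction with
  | zero => simp
  | add x y _ _ hx hy => simp only [mul_add, add_mul, map_add, hx, hy]; ring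
  | smul c x _ hx =>
    simp only [mul_smul_comm, smul_mul_assoc, map_smul, hx, smul_eq_mul]; ring
  | mem w hw =>
  obtain ⟨w, hwc, hwJ, rfl⟩ := hw
  -- for `w ≠ []` one has `Ψ(w) = 0`, and the concatenation `p ++ w ++ q` is again alternating
  rcases eq_or_ne w [] with rfl | hw0
  · simp [hΦ.1, hΨ.1]
  rw [hΨ.2 w hw0 hwc]
  induction hp using Submodule.span_induction with
  | zero => simp
  | add x y _ _ hx hy => simp only [add_mul, map_add, hx, hy]; ring
  | smul c x _ hx => simp only [smul_mul_assoc, map_smul, hx, smul_eq_mul]; ring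
  | mem p hp =>
  obtain ⟨p, hpc, hpI, rfl⟩ := hp
  induction hq using Submodule.span_induction with
  | zero => simp
  | add x y _ _ hx hy => simp only [mul_add, map_add, hx, hy]; ring
  | smul c x _ hx => simp only [mul_smul_comm, map_smul, hx, smul_eq_mul]; ring
  | mem q hq =>
  obtain ⟨q, hqc, hqI, rfl⟩ := hq
  have hc : IsCentredAlternating ψ (p ++ w ++ q) := by
    refine ⟨fun x hx => ?_, ?_⟩
    · simp only [List.mem_append] at hx
      rcases hx with (hx | hx) | hx
      · exact hpc.1 x hx
      · exact hwc.1 x hx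
      · exact hqc.1 x hx
    · simp only [List.map_append]
      have hpw : (p.map Prod.fst ++ w.map Prod.fst).IsChain (· ≠ ·) := by
        refine hpc.2.append hwc.2 fun x hx y hy => ?_
        obtain ⟨x, hx', rfl⟩ := List.mem_map.1 (List.mem_of_getLast? hx)
        obtain ⟨y, hy', rfl⟩ := List.mem_map.1 (List.mem_of_head? hy)
        exact hne (hpI x hx') (hwJ y hy')
      refine hpw.append hqc.2 fun x hx y hy => ?_
      rw [List.getLast?_append_of_ne_nil _ (by simpa using hw0)] at hx
      obtain ⟨x, hx', rfl⟩ := List.mem_map.1 (List.mem_of_getLast? hx)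
      obtain ⟨y, hy', rfl⟩ := List.mem_map.1 (List.mem_of_head? hy)
      exact (hne (hqI y hy') (hwJ x hx')).symm
  have h := hΦ.2 _ hc
  simp only [List.map_append, List.prod_append] at h
  rw [h, hΦ.2 p hpc, hΦ.2 q hqc, hΦ.2 w hwc]
  ring

/-! ### Splitting off an interval -/

theorem freeSystem_eq (hψ : ψ 1 = 1) : freeSystem ψ hψ = condFreeSystem ψ ψ hψ hψ := by
  have h : freeState ψ hψ = condFreeState ψ ψ hψ :=
    (isFreeState_iff.1 (isFreeState_freeState ψ hψ)).unique hψ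
      (isCondFreeState_condFreeState ψ ψ hψ)
  simp only [freeSystem, condFreeSystem, h]

section Interval

variable {n : ℕ} {P V Q : Finset (Fin n)}

theorem sort_append_sort {S T : Finset (Fin n)} (h : ∀ x ∈ S, ∀ y ∈ T, x < y) :
    (S ∪ T).sort = S.sort ++ T.sort := by
  have hs : (S.sort ++ T.sort).Pairwise (· < ·) := by
    rw [List.pairwise_append]
    exact ⟨(Finset.sortedLT_sort S).pairwise, (Finset.sortedLT_sort T).pairwise,
      fun x hx y hy => h x (by simpa using hx) y (by simpa using hy)⟩
  refine List.Perm.eq_of_sortedLE (Finset.sortedLT_sort _).sortedLE hs.sortedLT.sortedLE ?_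
  refine (List.perm_ext_iff_of_nodup (Finset.sort_nodup _ _) hs.sortedLT.nodup).2 fun x => ?_
  simp

/-- The decomposition of a moment at an interval `V` with left part `P` and right part `Q`. -/
theorem condFreeSystem_moment_interval (hφ : φ 1 = 1) (hψ : ψ 1 = 1)
    (hPV : ∀ x ∈ P, ∀ y ∈ V, x < y) (hVQ : ∀ x ∈ V, ∀ y ∈ Q, x < y)
    (hPQ : ∀ x ∈ P, ∀ y ∈ Q, x < y) (hall : P ∪ V ∪ Q = Finset.univ)
    {σ : Setoid (Fin n)} (hσ : IsSaturated σ V) (X : Fin n → A) :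
    (condFreeSystem φ ψ hφ hψ).moment σ X
      = (freeSystem ψ hψ).moment (restrict σ V) (subfamily X V)
          * (condFreeSystem φ ψ hφ hψ).moment (restrict σ Vᶜ) (subfamily X Vᶜ)
        + ((condFreeSystem φ ψ hφ hψ).moment (restrict σ V) (subfamily X V)
            - (freeSystem ψ hψ).moment (restrict σ V) (subfamily X V))
          * ((condFreeSystem φ ψ hφ hψ).moment (restrict σ P) (subfamily X P)
            * (condFreeSystem φ ψ hφ hψ).moment (restrict σ Q) (subfamily X Q)) := by
  have hVc : Vᶜ = P ∪ Q := by
    ext x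
    have hx := Finset.ext_iff.1 hall x
    simp only [Finset.mem_union, Finset.mem_univ, iff_true] at hx
    simp only [Finset.mem_compl, Finset.mem_union]
    refine ⟨fun h => by tauto, ?_⟩
    rintro (h | h) h'
    · exact lt_irrefl _ (hPV x h x h')
    · exact lt_irrefl _ (hVQ x h' x h)
  let W : Finset (Fin n) → FreePower A :=
    fun S => (S.sort.map fun j => copy (blockIndex σ j) (X j)).prod
  have hm : ∀ S, (condFreeSystem φ ψ hφ hψ).moment (restrict σ S) (subfamily X S)
      = condFreeState φ ψ hψ (W S) := fun S =>
    (condFreeSystem φ ψ hφ hψ).moment_restrict σ X S _ (ker_blockIndex σ)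
  have hm' : ∀ S, (freeSystem ψ hψ).moment (restrict σ S) (subfamily X S)
      = freeState ψ hψ (W S) := fun S =>
    (freeSystem ψ hψ).moment_restrict σ X S _ (ker_blockIndex σ)
  have hmn : (condFreeSystem φ ψ hφ hψ).moment σ X
      = condFreeState φ ψ hψ (W Finset.univ) := by
    simp only [W, Fin.sort_univ, ← List.ofFn_eq_map]
    rfl
  have hW : W Finset.univ = W P * W V * W Q := by
    simp only [W]
    rw [← hall, sort_append_sort, sort_append_sort hPV, List.map_append, List.map_append,
      List.prod_append, List.prod_append]
    intro x hx y hy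
    rcases Finset.mem_union.1 hx with hx | hx
    · exact hPQ x hx y hy
    · exact hVQ x hx y hy
  have hW' : W Vᶜ = W P * W Q := by
    simp only [W]
    rw [hVc, sort_append_sort hPQ, List.map_append, List.prod_append]
  have hd : Disjoint (blockIndex σ '' (↑Vᶜ : Set (Fin n))) (blockIndex σ '' (V : Set (Fin n))) := by
    rw [Set.disjoint_left]
    rintro _ ⟨x, hx, rfl⟩ ⟨y, hy, hxy⟩
    have : σ y x := (ker_blockIndex σ).le hxy
    simp only [Finset.coe_compl, Set.mem_compl_iff, Finset.mem_coe] at hx hy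
    exact hx (hσ y x this hy)
  have hmem : ∀ S T : Finset (Fin n), S ⊆ T →
      W S ∈ wordSpan ψ (blockIndex σ '' (T : Set (Fin n))) := fun S T hST =>
    prod_mem_wordSpan hψ _ X _ fun x hx =>
      ⟨x, Finset.mem_coe.2 (hST (by simpa using hx)), rfl⟩
  rw [hmn, hm, hm, hm, hm, hm', hW, hW']
  exact (isCondFreeState_condFreeState φ ψ hψ).apply_mul_mul (isFreeState_freeState ψ hψ) hd
    (hmem P _ (hVc ▸ Finset.subset_union_left)) (hmem V V subset_rfl)
    (hmem Q _ (hVc ▸ Finset.subset_union_right))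

/-- An interval which is a union of blocks and is enclosed by some other block splits off as a
free cumulant; if `φ = ψ`, then it need not be enclosed. -/
theorem condFreeSystem_cumulant_interval (hφ : φ 1 = 1) (hψ : ψ 1 = 1)
    (hPV : ∀ x ∈ P, ∀ y ∈ V, x < y) (hVQ : ∀ x ∈ V, ∀ y ∈ Q, x < y)
    (hPQ : ∀ x ∈ P, ∀ y ∈ Q, x < y) (hall : P ∪ V ∪ Q = Finset.univ)
    {π : Setoid (Fin n)} (hπ : IsSaturated π V) (h : φ = ψ ∨ ∃ a ∈ P, ∃ b ∈ Q, π a b)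
    (X : Fin n → A) :
    (condFreeSystem φ ψ hφ hψ).cumulant π X
      = (freeSystem ψ hψ).cumulant (restrict π V) (subfamily X V)
          * (condFreeSystem φ ψ hφ hψ).cumulant (restrict π Vᶜ) (subfamily X Vᶜ) := by
  rw [ExchangeabilitySystem.cumulant_eq_mobius, mobius_congr fun σ hσ =>
    condFreeSystem_moment_interval hφ hψ hPV hVQ hPQ hall (hπ.mono hσ) X, mobius_add,
    mobius_split (S := V) (f₁ := fun σ => (freeSystem ψ hψ).moment σ (subfamily X V))
      (f₂ := fun σ => (condFreeSystem φ ψ hφ hψ).moment σ (subfamily X Vᶜ)) fun _ _ => rfl,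
    if_pos hπ]
  simp only [ExchangeabilitySystem.cumulant_eq_mobius]
  rw [add_eq_left]
  rcases h with rfl | ⟨a, ha, b, hb, hab⟩
  · simp only [freeSystem_eq, sub_self, zero_mul]
    simp [mobius]
  · -- the remaining term does not see connections between `P` and its complement
    have hr : ∀ (σ : Setoid (Fin n)) (S : Finset (Fin n)),
        ((∀ x ∈ S, x ∈ P) ∨ ∀ x ∈ S, x ∉ P) →
        restrict (σ ⊓ Setoid.ker (· ∈ P)) S = restrict σ S := by
      intro σ S hS
      refine Setoid.ext fun i j => ⟨fun h => h.1, fun h => ⟨h, ?_⟩⟩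
      have hi := S.orderEmbOfFin_mem rfl i
      have hj := S.orderEmbOfFin_mem rfl j
      rcases hS with hS | hS
      · exact propext (iff_of_true (hS _ hi) (hS _ hj))
      · exact propext (iff_of_false (hS _ hi) (hS _ hj))
    refine mobius_eq_zero_of_inf (θ := Setoid.ker (· ∈ P)) (fun σ _ => ?_) fun h => ?_
    · rw [hr σ V (Or.inr fun x hx hx' => lt_irrefl _ (hPV x hx' x hx)),
        hr σ P (Or.inl fun _ hx => hx),
        hr σ Q (Or.inr fun x hx hx' => lt_irrefl _ (hPQ x hx' x hx))]
    · have : (a ∈ P) = (b ∈ P) := h hab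
      exact lt_irrefl _ (hPQ b (this ▸ ha) b hb)

/-- The relative form of `condFreeSystem_cumulant_interval` for `S ⊆ [n]`, in which `V` only has
to be an interval of `S`. It allows repeated splitting without iterated renumbering. -/
theorem condFreeSystem_cumulant_restrict_interval (hφ : φ 1 = 1) (hψ : ψ 1 = 1)
    (hPV : ∀ x ∈ P, ∀ y ∈ V, x < y) (hVQ : ∀ x ∈ V, ∀ y ∈ Q, x < y)
    (hPQ : ∀ x ∈ P, ∀ y ∈ Q, x < y) {S : Finset (Fin n)} (hS : P ∪ V ∪ Q = S)
    {π : Setoid (Fin n)} (hπ : ∀ x ∈ V, ∀ y ∈ S, π x y → y ∈ V)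
    (h : φ = ψ ∨ ∃ a ∈ P, ∃ b ∈ Q, π a b) (X : Fin n → A) :
    (condFreeSystem φ ψ hφ hψ).cumulant (restrict π S) (subfamily X S)
      = (freeSystem ψ hψ).cumulant (restrict π V) (subfamily X V)
          * (condFreeSystem φ ψ hφ hψ).cumulant (restrict π (S \ V)) (subfamily X (S \ V)) := by
  let e := S.orderEmbOfFin rfl
  have he : ∀ i, e i ∈ S := S.orderEmbOfFin_mem rfl
  have he' : ∀ x ∈ S, ∃ i, e i = x := fun x hx => by
    have : x ∈ Set.range e := by rw [Finset.range_orderEmbOfFin]; exact hx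
    exact this
  let pre : Finset (Fin n) → Finset (Fin S.card) := fun T => Finset.univ.filter (e · ∈ T)
  have hpre : ∀ T i, i ∈ pre T ↔ e i ∈ T := by simp [pre]
  have hlt : ∀ T T' : Finset (Fin n), (∀ x ∈ T, ∀ y ∈ T', x < y) →
      ∀ x ∈ pre T, ∀ y ∈ pre T', x < y := fun T T' hTT x hx y hy =>
    e.lt_iff_lt.1 (hTT _ ((hpre T x).1 hx) _ ((hpre T' y).1 hy))
  have hVS : V ⊆ S := fun x hx => by rw [← hS]; simp [hx]
  have hV : (pre V).map e.toEmbedding = V := by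
    ext x
    simp only [Finset.mem_map, hpre]
    refine ⟨by rintro ⟨i, hi, rfl⟩; exact hi, fun hx => ?_⟩
    obtain ⟨i, rfl⟩ := he' x (hVS hx)
    exact ⟨i, hx, rfl⟩
  have hVc : (pre V)ᶜ.map e.toEmbedding = S \ V := by
    ext x
    simp only [Finset.mem_map, Finset.mem_compl, hpre, Finset.mem_sdiff]
    refine ⟨by rintro ⟨i, hi, rfl⟩; exact ⟨he i, hi⟩, fun hx => ?_⟩
    obtain ⟨i, rfl⟩ := he' x hx.1
    exact ⟨i, hx.2, rfl⟩
  rw [condFreeSystem_cumulant_interval hφ hψ (hlt P V hPV) (hlt V Q hVQ) (hlt P Q hPQ) ?_ ?_ ?_,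
    ExchangeabilitySystem.cumulant_restrict_restrict,
    ExchangeabilitySystem.cumulant_restrict_restrict, hV, hVc]
  · ext i
    have := (Finset.ext_iff.1 hS _).2 (he i)
    simpa [hpre] using this
  · intro i j hij hi
    exact (hpre V j).2 (hπ _ ((hpre V i).1 hi) _ (he j) hij)
  · refine h.imp id ?_
    rintro ⟨a, ha, b, hb, hab⟩
    obtain ⟨i, rfl⟩ := he' a (by rw [← hS]; simp [ha])
    obtain ⟨j, rfl⟩ := he' b (by rw [← hS]; simp [hb])
    exact ⟨i, (hpre P i).2 ha, j, (hpre Q j).2 hb, hab⟩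

end Interval

/-! ### Factorization at an outer block -/

/-- If a block `B` of a noncrossing partition encloses all other points, the intervals between
consecutive points of `B` split off one after the other. -/
theorem condFreeSystem_cumulant_of_enclosing (hφ : φ 1 = 1) (hψ : ψ 1 = 1) {n : ℕ}
    {π : Setoid (Fin n)} (hπ : IsNoncrossing π) {B : Finset (Fin n)} (hB : IsSaturated π B)
    (hBB : ∀ x ∈ B, ∀ y ∈ B, π x y) (hl : ∀ x, ∃ a ∈ B, a ≤ x) (hr : ∀ x, ∃ b ∈ B, x ≤ b)
    (X : Fin n → A) (S : Finset (Fin n)) (hBS : B ⊆ S) :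
    (condFreeSystem φ ψ hφ hψ).cumulant (restrict π S) (subfamily X S)
      = (condFreeSystem φ ψ hφ hψ).cumulant (restrict π B) (subfamily X B)
          * (freeSystem ψ hψ).cumulant (restrict π (S \ B)) (subfamily X (S \ B)) := by
  induction S using Finset.strongInduction with
  | H S ih =>
  by_cases hx : ∃ x, x ∈ S ∧ x ∉ B
  · -- split off the gap `V` of `B` containing `x`, with end points `a` and `b`
    obtain ⟨x, hxS, hxB⟩ := hx
    obtain ⟨a, ha, hamax⟩ : ∃ a ∈ B.filter (· ≤ x), ∀ y ∈ B.filter (· ≤ x), y ≤ a :=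
      Finset.exists_max_image _ id (by
        obtain ⟨a, ha, hax⟩ := hl x
        exact ⟨a, Finset.mem_filter.2 ⟨ha, hax⟩⟩)
    obtain ⟨b, hb, hbmin⟩ : ∃ b ∈ B.filter (x ≤ ·), ∀ y ∈ B.filter (x ≤ ·), b ≤ y :=
      Finset.exists_min_image _ id (by
        obtain ⟨b, hb, hbx⟩ := hr x
        exact ⟨b, Finset.mem_filter.2 ⟨hb, hbx⟩⟩)
    simp only [Finset.mem_filter] at ha hb hamax hbmin
    obtain ⟨ha, hax⟩ := ha
    obtain ⟨hb, hxb⟩ := hb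
    have hax : a < x := lt_of_le_of_ne hax fun h => hxB (h ▸ ha)
    have hxb : x < b := lt_of_le_of_ne hxb fun h => hxB (h ▸ hb)
    have hgap : ∀ y ∈ B, y ≤ a ∨ b ≤ y := fun y hy =>
      (le_total y x).imp (fun h => hamax y ⟨hy, h⟩) fun h => hbmin y ⟨hy, h⟩
    set V := S.filter fun y => a < y ∧ y < b with hV
    have hVB : ∀ y ∈ V, y ∉ B := by
      intro y hy hyB
      simp only [hV, Finset.mem_filter] at hy
      rcases hgap y hyB with h | h
      · exact absurd h (not_le.2 hy.2.1)
      · exact absurd h (not_le.2 hy.2.2)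
    have hsat : ∀ y ∈ V, ∀ z ∈ S, π y z → z ∈ V := by
      intro y hy z hz hyz
      have hyB := hVB y hy
      have hzB : z ∉ B := fun h => hyB (hB z y (π.symm' hyz) h)
      have hza : z ≠ a := fun h => hzB (h ▸ ha)
      have hzb : z ≠ b := fun h => hzB (h ▸ hb)
      simp only [hV, Finset.mem_filter] at hy ⊢
      refine ⟨hz, ?_, ?_⟩
      · by_contra h
        exact hπ ⟨z, a, y, b, lt_of_le_of_ne (not_lt.1 h) hza, hy.2.1, hy.2.2, π.symm' hyz,
          hBB a ha b hb, fun h => hzB (hB a z (π.symm' h) ha)⟩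
      · by_contra h
        exact hπ ⟨a, y, b, z, hy.2.1, hy.2.2, lt_of_le_of_ne (not_lt.1 h) hzb.symm,
          hBB a ha b hb, hyz, fun h => hyB (hB a y h ha)⟩
    have hcover : ∀ T ⊆ S, V ⊆ T → T.filter (· ≤ a) ∪ V ∪ T.filter (b ≤ ·) = T := by
      intro T hTS hVT
      ext y
      simp only [Finset.mem_union, Finset.mem_filter]
      constructor
      · rintro ((h | h) | h)
        exacts [h.1, hVT h, h.1]
      · intro h
        by_cases h1 : y ≤ a
        · exact Or.inl (Or.inl ⟨h, h1⟩)
        · by_cases h2 : b ≤ y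
          · exact Or.inr ⟨h, h2⟩
          · exact Or.inl (Or.inr (by simpa [hV, hTS h] using ⟨not_le.1 h1, not_le.1 h2⟩))
    have hPV : ∀ T : Finset (Fin n), ∀ y ∈ T.filter (· ≤ a), ∀ z ∈ V, y < z := by
      intro T y hy z hz
      simp only [hV, Finset.mem_filter] at hy hz
      exact hy.2.trans_lt hz.2.1
    have hVQ : ∀ T : Finset (Fin n), ∀ y ∈ V, ∀ z ∈ T.filter (b ≤ ·), y < z := by
      intro T y hy z hz
      simp only [hV, Finset.mem_filter] at hy hz
      exact hy.2.2.trans_le hz.2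
    have hPQ : ∀ T : Finset (Fin n), ∀ y ∈ T.filter (· ≤ a), ∀ z ∈ T.filter (b ≤ ·), y < z := by
      intro T y hy z hz
      simp only [Finset.mem_filter] at hy hz
      exact hy.2.trans_lt ((hax.trans hxb).trans_le hz.2)
    have hVS : V ⊆ S := Finset.filter_subset _ _
    have hxV : x ∈ V := by simp [hV, hxS, hax, hxb]
    have hVSB : V ⊆ S \ B := fun y hy => Finset.mem_sdiff.2 ⟨hVS hy, hVB y hy⟩
    have h1 := condFreeSystem_cumulant_restrict_interval hφ hψ (hPV S) (hVQ S) (hPQ S)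
      (hcover S subset_rfl hVS) hsat (Or.inr ⟨a, by simp [hBS ha], b, by simp [hBS hb],
        hBB a ha b hb⟩) X
    have h2 := condFreeSystem_cumulant_restrict_interval hψ hψ (hPV (S \ B)) (hVQ (S \ B))
      (hPQ (S \ B)) (hcover (S \ B) Finset.sdiff_subset hVSB)
      (fun y hy z hz => hsat y hy z (Finset.sdiff_subset hz)) (Or.inl rfl) X
    rw [h1, ih (S \ V) (Finset.sdiff_ssubset hVS ⟨x, hxV⟩)
      fun y hy => Finset.mem_sdiff.2 ⟨hBS hy, fun h => hVB y h hy⟩, sdiff_right_comm,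
      freeSystem_eq, h2, freeSystem_eq]
    ring
  · have hSB : S = B := Finset.Subset.antisymm (fun x hx' => by
      by_contra h
      exact hx ⟨x, hx', h⟩) hBS
    rw [hSB, sdiff_self, Finset.bot_eq_empty, ExchangeabilitySystem.cumulant_empty, mul_one]

theorem component_eq_of_isNoncrossing {n : ℕ} {π : Setoid (Fin n)} (hπ : IsNoncrossing π) :
    component π = π := by
  refine le_antisymm (Setoid.eqvGen_le ?_) fun x y h => Relation.EqvGen.rel _ _ (Or.inl h)
  rintro x y (h | ⟨hn, i, j, k, l, hij, hjk, hkl, ⟨h1, h2, h3, h4⟩ | ⟨h1, h2, h3, h4⟩⟩)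
  · exact h
  · exact (hπ ⟨i, j, k, l, hij, hjk, hkl, π.trans' (π.symm' h1) h2, π.trans' (π.symm' h3) h4,
      fun h => hn (π.trans' h1 (π.trans' h (π.symm' h3)))⟩).elim
  · exact (hπ ⟨i, j, k, l, hij, hjk, hkl, π.trans' (π.symm' h1) h2, π.trans' (π.symm' h3) h4,
      fun h => hn (π.trans' h3 (π.trans' (π.symm' h) (π.symm' h1)))⟩).elim

/-- All four points of a crossing lie in the same connected component. -/
theorem exists_crossing_restrict {n : ℕ} {π : Setoid (Fin n)} (hπ : ¬ IsNoncrossing π) :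
    ¬ IsNoncrossing (restrict π (outerPart π)) ∨ ¬ IsNoncrossing (restrict π (innerPart π)) := by
  obtain ⟨a, b, c, d, hab, hbc, hcd, hac, hbd, hn⟩ := not_not.1 hπ
  have h1 : ∀ {x y}, π x y → component π x y := fun h => Relation.EqvGen.rel _ _ (Or.inl h)
  have h2 : component π a b := Relation.EqvGen.rel _ _ (Or.inr ⟨hn, a, b, c, d, hab, hbc, hcd,
    Or.inl ⟨π.refl' a, hac, π.refl' b, hbd⟩⟩)
  have h3 : ∀ {x y}, component π x y → (x ∈ outerPart π ↔ y ∈ outerPart π) := by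
    intro x y h
    simp only [outerPart, Finset.mem_filter, Finset.mem_univ, true_and]
    exact ⟨fun ⟨h0, hx⟩ => ⟨h0, (component π).trans' hx h⟩,
      fun ⟨h0, hy⟩ => ⟨h0, (component π).trans' hy ((component π).symm' h)⟩⟩
  have hb := h3 h2
  have hc := h3 (h1 hac)
  have hd := hb.trans (h3 (h1 hbd))
  by_cases ha : a ∈ outerPart π
  · exact Or.inl (not_isNoncrossing_restrict hab hbc hcd hac hbd hn ha (hb.1 ha) (hc.1 ha)
      (hd.1 ha))
  · simp only [innerPart]
    exact Or.inr (not_isNoncrossing_restrict hab hbc hcd hac hbd hn (by simpa using ha)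
      (by simpa [← hb] using ha) (by simpa [← hc] using ha) (by simpa [← hd] using ha))

end CFree

theorem mainTheorem9 {A : Type*} [Ring A] [Algebra ℂ A] (φ ψ : A →ₗ[ℂ] ℂ)
    (hφ : φ 1 = 1) (hψ : ψ 1 = 1) {n : ℕ} (π : Setoid (Fin n)) (X : Fin n → A) :
    (CFree.IsIrreducible π →
      (CFree.condFreeSystem φ ψ hφ hψ).cumulant π X
        = (CFree.condFreeSystem φ ψ hφ hψ).cumulant
            (CFree.restrict π (CFree.outerPart π)) (CFree.subfamily X (CFree.outerPart π))
          * (CFree.freeSystem ψ hψ).cumulant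
            (CFree.restrict π (CFree.innerPart π)) (CFree.subfamily X (CFree.innerPart π))
      ∧ (¬ CFree.IsNoncrossing (CFree.restrict π (CFree.innerPart π)) →
          (CFree.freeSystem ψ hψ).cumulant
            (CFree.restrict π (CFree.innerPart π)) (CFree.subfamily X (CFree.innerPart π)) = 0))
    ∧ (¬ CFree.IsNoncrossing π → (CFree.condFreeSystem φ ψ hφ hψ).cumulant π X = 0) := by
  have hfree : ¬ CFree.IsNoncrossing (CFree.restrict π (CFree.innerPart π)) →
      (CFree.freeSystem ψ hψ).cumulant
        (CFree.restrict π (CFree.innerPart π)) (CFree.subfamily X (CFree.innerPart π)) = 0 := by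
    intro h
    rw [CFree.freeSystem_eq]
    exact CFree.condFreeSystem_cumulant_eq_zero hψ hψ _ h _
  refine ⟨fun hirr => ⟨?_, hfree⟩, fun h => CFree.condFreeSystem_cumulant_eq_zero hφ hψ π h X⟩
  by_cases hπ : CFree.IsNoncrossing π
  · obtain ⟨h0, hlast⟩ := hirr
    -- the outer component is the block of the first point
    have hB : ∀ x, x ∈ CFree.outerPart π ↔ π ⟨0, h0⟩ x := by
      intro x
      simp only [CFree.outerPart, Finset.mem_filter, Finset.mem_univ, true_and]
      exact ⟨fun h => (CFree.component_eq_of_isNoncrossing hπ).le h.2,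
        fun h => ⟨h0, (CFree.component_eq_of_isNoncrossing hπ).ge h⟩⟩
    rw [CFree.component_eq_of_isNoncrossing hπ] at hlast
    have h := CFree.condFreeSystem_cumulant_of_enclosing hφ hψ hπ (B := CFree.outerPart π)
      (fun x y hxy hx => (hB y).2 (π.trans' ((hB x).1 hx) hxy))
      (fun x hx y hy => π.trans' (π.symm' ((hB x).1 hx)) ((hB y).1 hy))
      (fun x => ⟨_, (hB _).2 (π.refl' _), Fin.le_def.2 (Nat.zero_le _)⟩)
      (fun x => ⟨_, (hB _).2 hlast, Fin.le_def.2 (Nat.le_sub_one_of_lt x.isLt)⟩)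
      X Finset.univ (Finset.subset_univ _)
    rwa [CFree.ExchangeabilitySystem.cumulant_restrict_univ, ← Finset.compl_eq_univ_sdiff] at h
  · rw [CFree.condFreeSystem_cumulant_eq_zero hφ hψ π hπ X]
    rcases CFree.exists_crossing_restrict hπ with h | h
    · rw [CFree.condFreeSystem_cumulant_eq_zero hφ hψ _ h, zero_mul]
    · rw [hfree h, mul_zero]
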